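/- **Conventions.** Let $(M,\theta)$ be a strictly pseudoconvex pseudohermitian manifold of dimension $2n+1$: $M$ carries a formally integrable CR structure $T^{1,0}M$ of hypersurface type and CR dimension $n$, with complex structure $J$ on the holomorphic tangent space $\ker\theta=\operatorname{Re}(T^{1,0}M\oplus T^{0,1}M)$, and $d\theta(v,Jv)>0$ for $0\ne v\in\ker\theta$. Let $T$ be the Reeb field ($\theta(T)=1$, $d\theta(T,\cdot)=0$) and put $JT=0$. The Tanaka–Webster connection $\nabla$ is the affine connection for which $\ker\theta$, $J$, $T$ and $G_\theta=d\theta(\cdot,J\cdot)$ are parallel and whose torsion satisfies $\mathbb T_\nabla(u,v)=d\theta(u,v)T$ and $\mathbb T_\nabla(T,Jv)=-J\,\mathbb T_\nabla(T,v)$ for $u,v\in\ker\theta$; the pseudohermitian torsion is $\tau X=\mathbb T_\nabla(T,X)$. Let $(\mathcal X,\omega)$ be a Kähler manifold, with Riemannian metric $\langle u,v\rangle=\omega(u,\mathcal Jv)$, where $\mathcal J$ is its complex structure, and Chern connection $\widetilde\nabla$. Connections, $G_\theta$ and $\langle\cdot,\cdot\rangle$ are extended complex (bi)linearly to complexified tangent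 spaces. For the exterior derivative, $d\theta(U,V)=U\theta(V)-V\theta(U)-\theta([U,V])$; curvatures are $R(X,Y)Z=\nabla_X\nabla_YZ-\nabla_Y\nabla_XZ-\nabla_{[X,Y]}Z$, and likewise $\widetilde R$ for $\widetilde\nabla$. Let $\iota\colon M\to\mathcal X$ be a pseudohermitian submanifold, that is, a smooth CR immersion with $d\theta=\iota^*\omega$. Tangent vectors of $M$ are identified with their images under $d\iota$; on $\mathbb C\ker\theta$ the metric $\langle\cdot,\cdot\rangle$ agrees with $G_\theta$. The second fundamental form is $I\!I(U,V)=\widetilde\nabla_U\widetilde V-\nabla_UV$, where $\widetilde V$ is a local smooth extension of $V$ to $\mathcal X$. The $(1,0)$-mean curvature vector is $H=\frac1n\sum_{\alpha=1}^n I\!I(\overline{Z_\alpha},Z_\alpha)$ for an orthonormal basis $Z_1,\dots,Z_n$ of $T^{1,0}M$, i.e. $\langle Z_\alpha,\overline{Z_\beta}\rangle=\delta_{\alpha\beta}$, and $|H|^2=\langle H,\overline H\rangle$. **Proposition (equations of Gauß).** In this situation, at every point of $M$ and for every such orthonormal basis: 1. for all $X,Z\in T^{1,0}M$ and $\overline Y,\overline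 W\in T^{0,1}M$, $$\langle\widetilde R(X,\overline Y)Z,\overline W\rangle=\langle R(X,\overline Y)Z,\overline W\rangle+\langle I\!I(X,Z),I\!I(\overline Y,\overline W)\rangle-|H|^2\left(\langle\overline Y,Z\rangle\langle X,\overline W\rangle+\langle X,\overline Y\rangle\langle Z,\overline W\rangle\right);$$ 2. for all $X,Z\in T^{1,0}M$, $$\langle\tau X,Z\rangle=-i\,\langle I\!I(X,Z),\overline H\rangle.$$ -/

import Mathlib

open Bundle FiberBundle VectorField
open scoped Manifold ContDiff Topology

noncomputable section

namespace CRGeom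

/-! ### Complexification of real vector spaces and of real multilinear maps -/

/-- The complexification `ℂ ⊗ V` of a real vector space `V`: the pair `(x, y)` stands for
`x + i y`. -/
abbrev Cx (V : Type*) : Type _ := V × V

/-- Complex conjugation `x + i y ↦ x - i y`. -/
def Cx.conj {V : Type*} [Neg V] (v : Cx V) : Cx V := (v.1, -v.2)

/-- Complex-linear extension of a real linear map. -/
def Cx.map {V W : Type*} (f : V → W) (v : Cx V) : Cx W := (f v.1, f v.2)

/-- Complex-bilinear extension of a real bilinear form. -/
def Cx.form {V : Type*} (b : V → V → ℝ) (v w : Cx V) : ℂ :=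
  ⟨b v.1 w.1 - b v.2 w.2, b v.1 w.2 + b v.2 w.1⟩

/-- Complex-bilinear extension of a real bilinear map. -/
def Cx.map₂ {V W : Type*} [AddCommGroup W] (b : V → V → W) (v w : Cx V) : Cx W :=
  (b v.1 w.1 - b v.2 w.2, b v.1 w.2 + b v.2 w.1)

/-- Complex-trilinear extension of a real trilinear map. -/
def Cx.map₃ {V W : Type*} [AddCommGroup W] (t : V → V → V → W) (u v w : Cx V) : Cx W :=
  (t u.1 v.1 w.1 - t u.2 v.2 w.1 - t u.1 v.2 w.2 - t u.2 v.1 w.2,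
   t u.1 v.1 w.2 - t u.2 v.2 w.2 + t u.1 v.2 w.1 + t u.2 v.1 w.1)

/-! ### Exterior derivatives and affine connections on a smooth manifold

Tensors defined through derivatives of vector fields are evaluated on tangent vectors by extending
these to local smooth vector fields (`FiberBundle.extend`), as Mathlib does for the torsion. -/

section Manifold

variable {E : Type*} [NormedAddCommGroup E] [NormedSpace ℝ E]
  {M : Type*} [TopologicalSpace M] [ChartedSpace E M] [IsManifold 𝓘(ℝ, E) ∞ M]

/-- The exterior derivative of a one-form,
`dθ(u, v) = u(θ(V)) - v(θ(U)) - θ([U, V])` for local vector fields `U`, `V` extending `u`, `v`. -/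
def extDerivOne (θ : ∀ p : M, TangentSpace 𝓘(ℝ, E) p →L[ℝ] ℝ) (p : M)
    (u v : TangentSpace 𝓘(ℝ, E) p) : ℝ :=
  mvfderiv 𝓘(ℝ, E) (fun q => θ q (extend E v q)) p u
    - mvfderiv 𝓘(ℝ, E) (fun q => θ q (extend E u q)) p v
    - θ p (mlieBracket 𝓘(ℝ, E) (extend E u) (extend E v) p)

/-- The exterior derivative of a two-form, by the invariant formula
`dβ(u, v, w) = ∑ u(β(V, W)) - ∑ β([U, V], W)` (cyclic sums) for local vector fields `U`, `V`, `W`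
extending `u`, `v`, `w`. -/
def extDerivTwo (β : ∀ p : M, TangentSpace 𝓘(ℝ, E) p → TangentSpace 𝓘(ℝ, E) p → ℝ) (p : M)
    (u v w : TangentSpace 𝓘(ℝ, E) p) : ℝ :=
  mvfderiv 𝓘(ℝ, E) (fun q => β q (extend E v q) (extend E w q)) p u
    + mvfderiv 𝓘(ℝ, E) (fun q => β q (extend E w q) (extend E u q)) p v
    + mvfderiv 𝓘(ℝ, E) (fun q => β q (extend E u q) (extend E v q)) p w
    - β p (mlieBracket 𝓘(ℝ, E) (extend E u) (extend E v) p) w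
    - β p (mlieBracket 𝓘(ℝ, E) (extend E v) (extend E w) p) u
    - β p (mlieBracket 𝓘(ℝ, E) (extend E w) (extend E u) p) v

/-- The vector field `V` is smooth near `p`. -/
abbrev SmoothFieldAt (V : ∀ q : M, TangentSpace 𝓘(ℝ, E) q) (p : M) : Prop :=
  ContMDiffAt 𝓘(ℝ, E) (𝓘(ℝ, E).prod 𝓘(ℝ, E)) ∞ (fun q => TotalSpace.mk' E q (V q)) p

/-- The vector field `V` is differentiable at `p`. -/
abbrev DiffFieldAt (V : ∀ q : M, TangentSpace 𝓘(ℝ, E) q) (p : M) : Prop :=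
  MDifferentiableAt 𝓘(ℝ, E) (𝓘(ℝ, E).prod 𝓘(ℝ, E)) (fun q => TotalSpace.mk' E q (V q)) p

variable (E M) in
/-- Affine connections; `cov V p u` is `(∇_u V)(p)`. -/
abbrev AffineConnection : Type _ :=
  CovariantDerivative 𝓘(ℝ, E) E (TangentSpace 𝓘(ℝ, E) : M → Type _)

/-- A connection is smooth if it maps smooth local vector fields to smooth sections. -/
def IsSmoothConnection (cov : AffineConnection E M) : Prop :=
  ∀ U : Set M, IsOpen U → ContMDiffCovariantDerivativeOn E ∞ cov.toFun U

/-- The torsion tensor `𝕋(u, v) = ∇_U V - ∇_V U - [U, V]`. -/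
def torsionTensor [FiniteDimensional ℝ E] (cov : AffineConnection E M) (p : M)
    (u v : TangentSpace 𝓘(ℝ, E) p) : TangentSpace 𝓘(ℝ, E) p :=
  haveI : CompleteSpace E := FiniteDimensional.complete ℝ E
  cov.torsion p u v

/-- The curvature tensor `R(a, b) c = ∇_A ∇_B C - ∇_B ∇_A C - ∇_[A, B] C`. -/
def curvatureTensor (cov : AffineConnection E M) (p : M)
    (a b c : TangentSpace 𝓘(ℝ, E) p) : TangentSpace 𝓘(ℝ, E) p :=
  cov (fun q => cov (extend E c) q (extend E b q)) p a
    - cov (fun q => cov (extend E c) q (extend E a q)) p b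
    - cov (extend E c) p (mlieBracket 𝓘(ℝ, E) (extend E a) (extend E b) p)

end Manifold

/-! ### Strictly pseudoconvex pseudohermitian manifolds -/

section CR

variable (E : Type*) [NormedAddCommGroup E] [NormedSpace ℝ E]
  (M : Type*) [TopologicalSpace M] [ChartedSpace E M] [IsManifold 𝓘(ℝ, E) ∞ M]

/-- A strictly pseudoconvex pseudohermitian structure (of hypersurface type) on `M`: a contact form
`θ`, and a CR structure given by the complex structure `J` on the holomorphic tangent space
`ker θ`. As usual `J` is extended to the whole tangent bundle by `J T = 0`, where `T` is the Reeb
field of `θ`. -/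
structure PseudohermitianStructure where
  /-- the contact form -/
  θ : ∀ p : M, TangentSpace 𝓘(ℝ, E) p →L[ℝ] ℝ
  /-- the complex structure on `ker θ`, extended by `J T = 0` -/
  J : ∀ p : M, TangentSpace 𝓘(ℝ, E) p →L[ℝ] TangentSpace 𝓘(ℝ, E) p
  /-- the Reeb field, determined by `θ(T) = 1` and `dθ(T, ·) = 0` -/
  T : ∀ p : M, TangentSpace 𝓘(ℝ, E) p
  smooth_θ : ContMDiff 𝓘(ℝ, E) (𝓘(ℝ, E).prod 𝓘(ℝ, E →L[ℝ] ℝ)) ∞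
    (fun p => TotalSpace.mk' (E →L[ℝ] ℝ) p (θ p))
  smooth_J : ContMDiff 𝓘(ℝ, E) (𝓘(ℝ, E).prod 𝓘(ℝ, E →L[ℝ] E)) ∞
    (fun p => TotalSpace.mk' (E →L[ℝ] E) p (J p))
  smooth_T : ContMDiff 𝓘(ℝ, E) (𝓘(ℝ, E).prod 𝓘(ℝ, E)) ∞ (fun p => TotalSpace.mk' E p (T p))
  θ_T : ∀ p, θ p (T p) = 1
  dθ_T : ∀ p v, extDerivOne θ p (T p) v = 0
  J_T : ∀ p, J p (T p) = 0
  θ_J : ∀ p v, θ p v = 0 → θ p (J p v) = 0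
  J_J : ∀ p v, θ p v = 0 → J p (J p v) = -v
  /-- Formal integrability: for sections `X`, `Y` of `ker θ`, the bracket
  `[X - i J X, Y - i J Y]` is again of the form `A - i J A` with `A` in `ker θ`. -/
  integrable : ∀ (p : M) (X Y : ∀ q : M, TangentSpace 𝓘(ℝ, E) q),
    SmoothFieldAt X p → SmoothFieldAt Y p →
    (∀ᶠ q in 𝓝 p, θ q (X q) = 0) → (∀ᶠ q in 𝓝 p, θ q (Y q) = 0) →
    θ p (mlieBracket 𝓘(ℝ, E) X Y p
        - mlieBracket 𝓘(ℝ, E) (fun q => J q (X q)) (fun q => J q (Y q)) p) = 0 ∧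
    mlieBracket 𝓘(ℝ, E) X (fun q => J q (Y q)) p + mlieBracket 𝓘(ℝ, E) (fun q => J q (X q)) Y p
      = J p (mlieBracket 𝓘(ℝ, E) X Y p
        - mlieBracket 𝓘(ℝ, E) (fun q => J q (X q)) (fun q => J q (Y q)) p)
  /-- strict pseudoconvexity -/
  pos : ∀ p v, θ p v = 0 → v ≠ 0 → 0 < extDerivOne θ p v (J p v)

variable {E M}

namespace PseudohermitianStructure

variable (S : PseudohermitianStructure E M)

/-- `G_θ(u, v) = dθ(u, J v)`. -/
def leviMetric (p : M) (u v : TangentSpace 𝓘(ℝ, E) p) : ℝ := extDerivOne S.θ p u (S.J p v)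

/-- The space `T^{1,0}_p M` of vectors `x - i J x` with `x` in `ker θ`. Its conjugate is
`T^{0,1}_p M`. -/
def T10 (p : M) : Set (Cx (TangentSpace 𝓘(ℝ, E) p)) := {v | S.θ p v.1 = 0 ∧ v.2 = -S.J p v.1}

/-- `Z_1, …, Z_n` in `T^{1,0}_p M` with `⟨Z_α, conj Z_β⟩ = δ_{αβ}`. If `dim M = 2 n + 1`, this says
that they form an orthonormal basis of `T^{1,0}_p M`. -/
def IsOrthonormalBasis {n : ℕ} (p : M) (Z : Fin n → Cx (TangentSpace 𝓘(ℝ, E) p)) : Prop :=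
  (∀ α, Z α ∈ S.T10 p) ∧
    ∀ α β, Cx.form (S.leviMetric p) (Z α) (Cx.conj (Z β)) = if α = β then 1 else 0

/-- The Tanaka–Webster connection: `ker θ`, `J`, `T` and `G_θ` are parallel, and the torsion is
pure. -/
structure IsTanakaWebster [FiniteDimensional ℝ E] (cov : AffineConnection E M) : Prop where
  smooth : IsSmoothConnection cov
  parallel_H : ∀ (p : M) (V : ∀ q : M, TangentSpace 𝓘(ℝ, E) q) (u : TangentSpace 𝓘(ℝ, E) p),
    DiffFieldAt V p → (∀ᶠ q in 𝓝 p, S.θ q (V q) = 0) → S.θ p (cov V p u) = 0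
  parallel_J : ∀ (p : M) (V : ∀ q : M, TangentSpace 𝓘(ℝ, E) q) (u : TangentSpace 𝓘(ℝ, E) p),
    DiffFieldAt V p → cov (fun q => S.J q (V q)) p u = S.J p (cov V p u)
  parallel_T : ∀ (p : M) (u : TangentSpace 𝓘(ℝ, E) p), cov S.T p u = 0
  parallel_G : ∀ (p : M) (V W : ∀ q : M, TangentSpace 𝓘(ℝ, E) q) (u : TangentSpace 𝓘(ℝ, E) p),
    DiffFieldAt V p → DiffFieldAt W p →
    mvfderiv 𝓘(ℝ, E) (fun q => S.leviMetric q (V q) (W q)) p u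
      = S.leviMetric p (cov V p u) (W p) + S.leviMetric p (V p) (cov W p u)
  torsion_H : ∀ (p : M) (u v : TangentSpace 𝓘(ℝ, E) p), S.θ p u = 0 → S.θ p v = 0 →
    torsionTensor cov p u v = extDerivOne S.θ p u v • S.T p
  torsion_T : ∀ (p : M) (v : TangentSpace 𝓘(ℝ, E) p), S.θ p v = 0 →
    torsionTensor cov p (S.T p) (S.J p v) = -S.J p (torsionTensor cov p (S.T p) v)

end PseudohermitianStructure

end CR

/-! ### Kähler manifolds -/

section Kahler

variable {E : Type*} [NormedAddCommGroup E] [NormedSpace ℂ E]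
  {X : Type*} [TopologicalSpace X] [ChartedSpace E X]

/-- A complex manifold is in particular a smooth real manifold. -/
instance isManifold_real [IsManifold 𝓘(ℂ, E) ω X] : IsManifold 𝓘(ℝ, E) ∞ X := by
  refine isManifold_of_contDiffOn _ _ _ fun e e' he he' => ?_
  have h := (contDiffGroupoid ω 𝓘(ℂ, E)).compatible he he'
  rw [contDiffGroupoid, mem_groupoid_of_pregroupoid] at h
  exact (h.1.restrict_scalars ℝ).of_le le_top

/-- Multiplication by `i` on the real tangent spaces of a complex manifold. (The real tangent space
at `x` is identified with the model space by the preferred holomorphic chart at `x`.) -/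
def complexStructure (x : X) : TangentSpace 𝓘(ℝ, E) x →L[ℝ] TangentSpace 𝓘(ℝ, E) x :=
  (Complex.I • ContinuousLinearMap.id ℝ E : E →L[ℝ] E)

variable [IsManifold 𝓘(ℂ, E) ω X]

variable (E X) in
/-- Smooth Riemannian metrics on the underlying real manifold. -/
abbrev RealMetric : Type _ :=
  ContMDiffRiemannianMetric 𝓘(ℝ, E) ∞ E (TangentSpace 𝓘(ℝ, E) : X → Type _)

/-- `⟨u, v⟩` as a real bilinear form on the tangent space at `x`. -/
def RealMetric.val (g : RealMetric E X) (x : X) (u v : TangentSpace 𝓘(ℝ, E) x) : ℝ :=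
  g.inner x u v

/-- The fundamental form `ω(u, v) = ⟨i u, v⟩`, so that `⟨u, v⟩ = ω(u, i v)`. -/
def fundamentalForm (g : RealMetric E X) (x : X) (u v : TangentSpace 𝓘(ℝ, E) x) : ℝ :=
  g.val x (complexStructure x u) v

/-- The metric is Hermitian and its fundamental form is closed. -/
structure IsKahler (g : RealMetric E X) : Prop where
  hermitian : ∀ (x : X) (u v : TangentSpace 𝓘(ℝ, E) x),
    g.val x (complexStructure x u) (complexStructure x v) = g.val x u v
  closed : ∀ (x : X) (u v w : TangentSpace 𝓘(ℝ, E) x), extDerivTwo (fundamentalForm g) x u v w = 0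

/-- The Chern connection of a Hermitian metric: the metric and the complex structure are parallel,
and the `(1,1)`-part of the torsion vanishes (equivalently, the `(0,1)`-part of the connection on
`T^{1,0}X` is the Cauchy–Riemann operator). In real terms, `𝕋(Z, W̄) = 0` for all `Z`, `W` of type
`(1,0)` says that `𝕋(i u, v) = 𝕋(u, i v)` for all real `u`, `v`. -/
structure IsChernConnection [FiniteDimensional ℝ E] (g : RealMetric E X)
    (cov : AffineConnection E X) : Prop where
  smooth : IsSmoothConnection cov
  parallel_g : ∀ (x : X) (V W : ∀ y : X, TangentSpace 𝓘(ℝ, E) y) (u : TangentSpace 𝓘(ℝ, E) x),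
    DiffFieldAt V x → DiffFieldAt W x →
    mvfderiv 𝓘(ℝ, E) (fun y => g.val y (V y) (W y)) x u
      = g.val x (cov V x u) (W x) + g.val x (V x) (cov W x u)
  parallel_J : ∀ (x : X) (V : ∀ y : X, TangentSpace 𝓘(ℝ, E) y) (u : TangentSpace 𝓘(ℝ, E) x),
    DiffFieldAt V x →
    cov (fun y => complexStructure y (V y)) x u = complexStructure x (cov V x u)
  torsion_11 : ∀ (x : X) (u v : TangentSpace 𝓘(ℝ, E) x),
    torsionTensor cov x (complexStructure x u) v = torsionTensor cov x u (complexStructure x v)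

end Kahler

/-! ### Pseudohermitian submanifolds and their second fundamental form -/

section Submanifold

variable {E : Type*} [NormedAddCommGroup E] [NormedSpace ℝ E]
  {M : Type*} [TopologicalSpace M] [ChartedSpace E M] [IsManifold 𝓘(ℝ, E) ∞ M]
  {E' : Type*} [NormedAddCommGroup E'] [NormedSpace ℂ E']
  {X : Type*} [TopologicalSpace X] [ChartedSpace E' X] [IsManifold 𝓘(ℂ, E') ω X]

/-- The differential of `F` at `p`. -/
abbrev push (F : M → X) (p : M) : TangentSpace 𝓘(ℝ, E) p →L[ℝ] TangentSpace 𝓘(ℝ, E') (F p) :=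
  mfderiv 𝓘(ℝ, E) 𝓘(ℝ, E') F p

/-- `(M, θ)` is a pseudohermitian submanifold of the Hermitian manifold `X` through `F`: a smooth
CR immersion with `dθ = F^* ω`. -/
structure IsPseudohermitianSubmanifold (S : PseudohermitianStructure E M) (g : RealMetric E' X)
    (F : M → X) : Prop where
  immersion : Manifold.IsImmersion 𝓘(ℝ, E) 𝓘(ℝ, E') ∞ F
  cr : ∀ (p : M) (v : TangentSpace 𝓘(ℝ, E) p), S.θ p v = 0 →
    push F p (S.J p v) = complexStructure (E := E') (F p) (push F p v)
  semiIsometric : ∀ (p : M) (u v : TangentSpace 𝓘(ℝ, E) p),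
    extDerivOne S.θ p u v = fundamentalForm g (F p) (push F p u) (push F p v)

/-- The vector field `V'` on `X`, smooth near `F p`, extends the vector field `V` tangent to `M`
near `p`. -/
def IsAmbientExtension (F : M → X) (p : M) (V : ∀ q : M, TangentSpace 𝓘(ℝ, E) q)
    (V' : ∀ x : X, TangentSpace 𝓘(ℝ, E') x) : Prop :=
  SmoothFieldAt V' (F p) ∧ ∀ᶠ q in 𝓝 p, V' (F q) = push F q (V q)

/-- The second fundamental form `II(u, v) = ∇'_U V' - ∇_U V` at `p`, where `V` is a local vector
field on `M` extending `v`, and `V'` is a smooth extension of `V` to a neighbourhood in `X` (for an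
immersion it exists, and the value does not depend on the choices). -/
def secondFundamentalForm (F : M → X) (cov' : AffineConnection E' X) (cov : AffineConnection E M)
    (p : M) (u v : TangentSpace 𝓘(ℝ, E) p) : TangentSpace 𝓘(ℝ, E') (F p) :=
  cov' (Classical.epsilon (IsAmbientExtension F p (extend E v))) (F p) (push F p u)
    - push F p (cov (extend E v) p u)

/-- The complex-bilinear extension of the second fundamental form. -/
def II (F : M → X) (cov' : AffineConnection E' X) (cov : AffineConnection E M) (p : M)
    (u v : Cx (TangentSpace 𝓘(ℝ, E) p)) : Cx (TangentSpace 𝓘(ℝ, E') (F p)) :=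
  Cx.map₂ (secondFundamentalForm F cov' cov p) u v

/-- The `(1,0)`-mean curvature vector `H = (1/n) ∑ II(conj Z_α, Z_α)` at `p`, computed in the
orthonormal basis `Z_1, …, Z_n` of `T^{1,0}_p M`. -/
def meanCurvature (F : M → X) (cov' : AffineConnection E' X) (cov : AffineConnection E M) (p : M)
    {n : ℕ} (Z : Fin n → Cx (TangentSpace 𝓘(ℝ, E) p)) : Cx (TangentSpace 𝓘(ℝ, E') (F p)) :=
  (n : ℝ)⁻¹ • ∑ α, II F cov' cov p (Cx.conj (Z α)) (Z α)

end Submanifold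

end CRGeom

end

open CRGeom

/-!
The proof compares the two connections along `ι`. Write `D = dι`, let `t = D T` be the image of the
Reeb field and `𝒥` the complex structure of the ambient manifold.

The Chern connection of a Kähler metric is torsion free (`torsionTensor_eq_zero`). Therefore
`II(u, v) - II(v, u) = -D 𝕋(u, v)`, which is `-dθ(u, v) t` for horizontal `u`, `v`. Since the complex
structures are parallel, `II(u, J v) = 𝒥 II(u, v)` for horizontal `v`. Since the metrics are parallel
and agree on horizontal vectors, `⟨II(u, v), D w⟩` is skew in horizontal `v`, `w`; together with its
symmetry in horizontal `u`, `v` (as `t` is orthogonal to horizontal vectors) this makes `II(u, v)`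
orthogonal to horizontal vectors (`hessian_orthogonal`). Differentiating these relations once more
gives an equation of Gauß for horizontal vectors (`gauss`), which contains an additional summand
`dθ(a, b) ⟨II(T, c), D d⟩` because brackets of horizontal fields have a component along the Reeb
field.

The remaining steps are algebra at one point. The two rules for exchanging and rotating the arguments
give `II(conj y, z) = ⟨conj y, z⟩ H` with `H = (𝒥 t + i t) / 2` for `y`, `z` of type `(1, 0)`
(`map₂_conj_left`), so `H` is the mean curvature vector and `|H|² = |t|² / 2`. As `T` is parallel
and orthogonal to horizontal vectors, `⟨II(T, z), w⟩ = -⟨t, II(z, w)⟩ - ⟨τ z, w⟩`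
(`torsion_complex`). For `z` of type `(1, 0)` and `w` of type `(0, 1)` this evaluates the additional
summand, as `τ` reverses types; for `z` and `w` both of type `(1, 0)` the left side vanishes, and the
relation is the equation for the pseudohermitian torsion.

All objects are computed in charts: connections through their Christoffel symbols, and the ambient
derivative along `ι` through covariant derivatives of fields along a map of model spaces.
-/

noncomputable section

namespace CRGeom

/-! ### Connections along maps between model spaces -/

section Local

lemma minSmoothness_two_le_infty : minSmoothness ℝ 2 ≤ (∞ : WithTop ℕ∞) := by
  rw [minSmoothness_of_isRCLikeNormedField]
  exact WithTop.coe_le_coe.2 le_top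

variable {E : Type*} [NormedAddCommGroup E] [NormedSpace ℝ E]
  {E' : Type*} [NormedAddCommGroup E'] [NormedSpace ℝ E']

/-- The covariant derivative `D_a w` at `y` of a vector field `w` along the map `F`, for the
connection with Christoffel symbols `Γ' x v u = ∇_u v - ∂_u v`. For `F = id` this is the
covariant derivative of vector fields. -/
def covAlong (F : E → E') (Γ' : E' → E' →L[ℝ] E' →L[ℝ] E') (w : E → E') (y a : E) : E' :=
  fderiv ℝ w y a + Γ' (F y) (w y) (fderiv ℝ F y a)

/-- The curvature `R(a, b) c` of the connection with Christoffel symbols `Γ`. -/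
def christoffelCurvature (Γ : E → E →L[ℝ] E →L[ℝ] E) (y a b c : E) : E :=
  fderiv ℝ Γ y a c b - fderiv ℝ Γ y b c a + Γ y (Γ y c b) a - Γ y (Γ y c a) b

/-- The second fundamental form `D_u (dF v) - dF (∇_u v)` of the map `F`. -/
def hessianAlong (F : E → E') (Γ' : E' → E' →L[ℝ] E' →L[ℝ] E') (Γ : E → E →L[ℝ] E →L[ℝ] E)
    (y u v : E) : E' :=
  fderiv ℝ (fderiv ℝ F) y u v + Γ' (F y) (fderiv ℝ F y v) (fderiv ℝ F y u)
    - fderiv ℝ F y (Γ y v u)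

variable {F : E → E'} {Γ' : E' → E' →L[ℝ] E' →L[ℝ] E'} {Γ : E → E →L[ℝ] E →L[ℝ] E} {y : E}

lemma covAlong_id (v : E → E) (y a : E) :
    covAlong (fun x => x) Γ v y a = fderiv ℝ v y a + Γ y (v y) a := by
  simp [covAlong]

lemma covAlong_add {w₁ w₂ : E → E'} (h₁ : DifferentiableAt ℝ w₁ y) (h₂ : DifferentiableAt ℝ w₂ y)
    (a : E) : covAlong F Γ' (fun x => w₁ x + w₂ x) y a = covAlong F Γ' w₁ y a +
      covAlong F Γ' w₂ y a := by
  simp only [covAlong, fderiv_fun_add h₁ h₂, map_add, add_apply]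
  abel

lemma _root_.ContDiffAt.differentiableAt_fderiv {F : E → E'} {y : E} (hF : ContDiffAt ℝ ∞ F y) :
    DifferentiableAt ℝ (fderiv ℝ F) y :=
  (hF.fderiv_right (m := 1) (by decide)).differentiableAt one_ne_zero

/-- The Gauss formula. -/
lemma covAlong_fderiv_apply (hF : ContDiffAt ℝ ∞ F y) {v : E → E} (hv : DifferentiableAt ℝ v y)
    (a : E) :
    covAlong F Γ' (fun x => fderiv ℝ F x (v x)) y a
      = fderiv ℝ F y (covAlong (fun x => x) Γ v y a) + hessianAlong F Γ' Γ y a (v y) := by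
  have h := hF.differentiableAt_fderiv
  rw [covAlong_id, covAlong, fderiv_clm_apply h hv, hessianAlong]
  simp
  abel

/-- Curvature measures the failure of covariant derivatives along a map to commute. -/
lemma covAlong_comm (hF : ContDiffAt ℝ ∞ F y) (hΓ : DifferentiableAt ℝ Γ' (F y))
    {w : E → E'} (hw : ContDiffAt ℝ ∞ w y) {A B : E → E} (hA : DifferentiableAt ℝ A y)
    (hB : DifferentiableAt ℝ B y) :
    covAlong F Γ' (fun x => covAlong F Γ' w x (B x)) y (A y)
      - covAlong F Γ' (fun x => covAlong F Γ' w x (A x)) y (B y)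
      = christoffelCurvature Γ' (F y) (fderiv ℝ F y (A y)) (fderiv ℝ F y (B y)) (w y)
        + covAlong F Γ' w y (fderiv ℝ B y (A y) - fderiv ℝ A y (B y)) := by
  have hF1 := hF.differentiableAt_fderiv
  have hF0 : DifferentiableAt ℝ F y := hF.differentiableAt (by simp)
  have hw1 := hw.differentiableAt_fderiv
  have hw0 : DifferentiableAt ℝ w y := hw.differentiableAt (by simp)
  have hΓF : DifferentiableAt ℝ (fun x => Γ' (F x)) y := 
    DifferentiableAt.comp (G := E' →L[ℝ] E' →L[ℝ] E') (g := Γ') y hΓ hF0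
  have hΓd : ∀ a, fderiv ℝ (fun x => Γ' (F x)) y a = fderiv ℝ Γ' (F y) (fderiv ℝ F y a) := by
    intro a
    have := fderiv_comp (G := E' →L[ℝ] E' →L[ℝ] E') (g := Γ') y hΓ hF0
    rw [show (fun x => Γ' (F x)) = Γ' ∘ F from rfl, this]; rfl
  have hsF : fderiv ℝ (fderiv ℝ F) y (A y) (B y) = fderiv ℝ (fderiv ℝ F) y (B y) (A y) :=
    (hF.isSymmSndFDerivAt minSmoothness_two_le_infty).eq _ _
  have hsw : fderiv ℝ (fderiv ℝ w) y (A y) (B y) = fderiv ℝ (fderiv ℝ w) y (B y) (A y) :=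
    (hw.isSymmSndFDerivAt minSmoothness_two_le_infty).eq _ _
  have key : ∀ {C : E → E}, DifferentiableAt ℝ C y → ∀ a,
      fderiv ℝ (fun x => covAlong F Γ' w x (C x)) y a
        = fderiv ℝ (fderiv ℝ w) y a (C y) + fderiv ℝ w y (fderiv ℝ C y a)
          + (fderiv ℝ Γ' (F y) (fderiv ℝ F y a) (w y) (fderiv ℝ F y (C y))
            + Γ' (F y) (fderiv ℝ w y a) (fderiv ℝ F y (C y))
            + Γ' (F y) (w y) (fderiv ℝ (fderiv ℝ F) y a (C y) + fderiv ℝ F y (fderiv ℝ C y a))) := by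
    intro C hC a
    unfold covAlong
    rw [fderiv_fun_add (hw1.clm_apply hC) ((hΓF.clm_apply hw0).clm_apply (hF1.clm_apply hC)),
      fderiv_clm_apply hw1 hC, fderiv_clm_apply (hΓF.clm_apply hw0) (hF1.clm_apply hC),
      fderiv_clm_apply hΓF hw0, fderiv_clm_apply hF1 hC]
    simp [hΓd]
    abel
  have ec : ∀ (u : E → E') (a : E),
      covAlong F Γ' u y a = fderiv ℝ u y a + Γ' (F y) (u y) (fderiv ℝ F y a) := fun _ _ => rfl
  rw [ec (fun x => covAlong F Γ' w x (B x)), ec (fun x => covAlong F Γ' w x (A x)), key hA, key hB]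
  simp only [covAlong, christoffelCurvature, map_add, map_sub, add_apply,
    hsF, hsw]
  abel

lemma fderiv_metric_along {g : E' → E' →L[ℝ] E' →L[ℝ] ℝ} (hF : DifferentiableAt ℝ F y)
    (hg : DifferentiableAt ℝ g (F y))
    (hpar : ∀ a u v, fderiv ℝ g (F y) a u v = g (F y) (Γ' (F y) u a) v + g (F y) u (Γ' (F y) v a))
    {w₁ w₂ : E → E'} (h₁ : DifferentiableAt ℝ w₁ y) (h₂ : DifferentiableAt ℝ w₂ y) (a : E) :
    fderiv ℝ (fun x => g (F x) (w₁ x) (w₂ x)) y a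
      = g (F y) (covAlong F Γ' w₁ y a) (w₂ y) + g (F y) (w₁ y) (covAlong F Γ' w₂ y a) := by
  have hgF : DifferentiableAt ℝ (fun x => g (F x)) y := 
    DifferentiableAt.comp (G := E' →L[ℝ] E' →L[ℝ] ℝ) (g := g) y hg hF
  have hgd : fderiv ℝ (fun x => g (F x)) y a = fderiv ℝ g (F y) (fderiv ℝ F y a) := by
    have := fderiv_comp (G := E' →L[ℝ] E' →L[ℝ] ℝ) (g := g) y hg hF
    rw [show (fun x => g (F x)) = g ∘ F from rfl, this]; rfl
  rw [fderiv_clm_apply (hgF.clm_apply h₁) h₂, fderiv_clm_apply hgF h₁]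
  simp [hgd, hpar, covAlong]
  abel

end Local

/-! ### The second fundamental form and the equation of Gauß in coordinates -/

section LocalGauss

variable {E : Type*} [NormedAddCommGroup E] [NormedSpace ℝ E]
  {E' : Type*} [NormedAddCommGroup E'] [NormedSpace ℂ E']

/-- The expression in local coordinates, on the open set `U`, of a pseudohermitian submanifold
`F` of a Kähler manifold: `Γ`, `θ`, `J`, `T` are the Christoffel symbols of the Tanaka–Webster
connection, the contact form, the complex structure and the Reeb field, and `Γ'`, `g` are the
Christoffel symbols and the metric of the ambient manifold. The form `dθ` enters only
through `dθ(u, v) = g (i dF u) (dF v)`. -/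
structure IsLocalPseudohermitianSubmanifold (U : Set E) (F : E → E') (Γ : E → E →L[ℝ] E →L[ℝ] E)
    (Γ' : E' → E' →L[ℝ] E' →L[ℝ] E') (θ : E → E →L[ℝ] ℝ) (J : E → E →L[ℝ] E) (T : E → E)
    (g : E' → E' →L[ℝ] E' →L[ℝ] ℝ) : Prop where
  isOpen : IsOpen U
  smooth_F : ∀ y ∈ U, ContDiffAt ℝ ∞ F y
  smooth_Γ : ∀ y ∈ U, ContDiffAt ℝ ∞ Γ y
  smooth_Γ' : ∀ y ∈ U, ContDiffAt ℝ ∞ Γ' (F y)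
  smooth_θ : ∀ y ∈ U, ContDiffAt ℝ ∞ θ y
  smooth_J : ∀ y ∈ U, ContDiffAt ℝ ∞ J y
  smooth_T : ∀ y ∈ U, ContDiffAt ℝ ∞ T y
  smooth_g : ∀ y ∈ U, ContDiffAt ℝ ∞ g (F y)
  g_symm : ∀ y ∈ U, ∀ u v, g (F y) u v = g (F y) v u
  g_I : ∀ y ∈ U, ∀ u v, g (F y) (Complex.I • u) (Complex.I • v) = g (F y) u v
  g_parallel : ∀ y ∈ U, ∀ a u v,
    fderiv ℝ g (F y) a u v = g (F y) (Γ' (F y) u a) v + g (F y) u (Γ' (F y) v a)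
  Γ'_symm : ∀ y ∈ U, ∀ u v, Γ' (F y) u v = Γ' (F y) v u
  Γ'_I : ∀ y ∈ U, ∀ u v, Γ' (F y) (Complex.I • u) v = Complex.I • Γ' (F y) u v
  θ_T : ∀ y ∈ U, θ y (T y) = 1
  θ_J : ∀ y ∈ U, ∀ v, θ y v = 0 → θ y (J y v) = 0
  J_J : ∀ y ∈ U, ∀ v, θ y v = 0 → J y (J y v) = -v
  cr : ∀ y ∈ U, ∀ v, θ y v = 0 → fderiv ℝ F y (J y v) = Complex.I • fderiv ℝ F y v
  reeb : ∀ y ∈ U, ∀ v, g (F y) (Complex.I • fderiv ℝ F y (T y)) (fderiv ℝ F y v) = 0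
  θ_parallel : ∀ y ∈ U, ∀ (V : E → E) (a : E), DifferentiableAt ℝ V y →
    (∀ᶠ x in 𝓝 y, θ x (V x) = 0) → θ y (covAlong (fun x => x) Γ V y a) = 0
  J_parallel : ∀ y ∈ U, ∀ (V : E → E) (a : E), DifferentiableAt ℝ V y →
    covAlong (fun x => x) Γ (fun x => J x (V x)) y a = J y (covAlong (fun x => x) Γ V y a)
  T_parallel : ∀ y ∈ U, ∀ a, covAlong (fun x => x) Γ T y a = 0
  levi_parallel : ∀ y ∈ U, ∀ (V W : E → E) (a : E),
    DifferentiableAt ℝ V y → DifferentiableAt ℝ W y →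
    fderiv ℝ (fun x => g (F x) (Complex.I • fderiv ℝ F x (V x)) (fderiv ℝ F x (J x (W x)))) y a
      = g (F y) (Complex.I • fderiv ℝ F y (covAlong (fun x => x) Γ V y a))
          (fderiv ℝ F y (J y (W y)))
        + g (F y) (Complex.I • fderiv ℝ F y (V y))
          (fderiv ℝ F y (J y (covAlong (fun x => x) Γ W y a)))
  torsion : ∀ y ∈ U, ∀ u v, θ y u = 0 → θ y v = 0 →
    Γ y v u - Γ y u v = g (F y) (Complex.I • fderiv ℝ F y u) (fderiv ℝ F y v) • T y

namespace IsLocalPseudohermitianSubmanifold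

variable {U : Set E} {F : E → E'} {Γ : E → E →L[ℝ] E →L[ℝ] E}
  {Γ' : E' → E' →L[ℝ] E' →L[ℝ] E'} {θ : E → E →L[ℝ] ℝ} {J : E → E →L[ℝ] E} {T : E → E}
  {g : E' → E' →L[ℝ] E' →L[ℝ] ℝ}
  (H : IsLocalPseudohermitianSubmanifold U F Γ Γ' θ J T g) {y : E}

include H

/-- Every horizontal vector at `y` extends to a smooth horizontal vector field. -/
lemma exists_horizontal {v : E} (hv : θ y v = 0) :
    ∃ V : E → E, V y = v ∧ (∀ x ∈ U, ContDiffAt ℝ ∞ V x) ∧ ∀ x ∈ U, θ x (V x) = 0 := by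
  refine ⟨fun x => v - θ x v • T x, by simp [hv], fun x hx => ?_, fun x hx => ?_⟩
  · have := H.smooth_θ x hx
    have := H.smooth_T x hx
    fun_prop
  · simp [H.θ_T x hx]

lemma metric_fderiv (hy : y ∈ U) {w₁ w₂ : E → E'} (h₁ : DifferentiableAt ℝ w₁ y)
    (h₂ : DifferentiableAt ℝ w₂ y) (a : E) :
    fderiv ℝ (fun x => g (F x) (w₁ x) (w₂ x)) y a
      = g (F y) (covAlong F Γ' w₁ y a) (w₂ y) + g (F y) (w₁ y) (covAlong F Γ' w₂ y a) :=
  fderiv_metric_along ((H.smooth_F y hy).differentiableAt (by simp))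
    ((H.smooth_g y hy).differentiableAt (by simp)) (H.g_parallel y hy) h₁ h₂ a

lemma levi_eq (hy : y ∈ U) (u : E) {v : E} (hv : θ y v = 0) :
    g (F y) (Complex.I • fderiv ℝ F y u) (fderiv ℝ F y (J y v))
      = g (F y) (fderiv ℝ F y u) (fderiv ℝ F y v) := by
  rw [H.cr y hy v hv, H.g_I y hy]

lemma fderiv_T_orthogonal (hy : y ∈ U) {v : E} (hv : θ y v = 0) :
    g (F y) (fderiv ℝ F y (T y)) (fderiv ℝ F y v) = 0 := by
  rw [← H.levi_eq hy _ hv, H.reeb y hy]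

/-- The second fundamental form is complex linear in its second, horizontal, argument. -/
lemma hessian_J (hy : y ∈ U) (u : E) {v : E} (hv : θ y v = 0) :
    hessianAlong F Γ' Γ y u (J y v) = Complex.I • hessianAlong F Γ' Γ y u v := by
  obtain ⟨V, rfl, hV, hθ⟩ := H.exists_horizontal hv
  have hVd := (hV y hy).differentiableAt (by simp)
  have hF := H.smooth_F y hy
  have hJd := (H.smooth_J y hy).differentiableAt (by simp)
  have hF1 := hF.differentiableAt_fderiv
  have h1 := covAlong_fderiv_apply (Γ' := Γ') (Γ := Γ) hF (hJd.clm_apply hVd) u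
  have h2 := covAlong_fderiv_apply (Γ' := Γ') (Γ := Γ) hF hVd u
  have hev : (fun x => fderiv ℝ F x (J x (V x))) =ᶠ[𝓝 y]
      fun x => Complex.I • fderiv ℝ F x (V x) := by
    filter_upwards [H.isOpen.mem_nhds hy] with x hx
    exact H.cr x hx _ (hθ x hx)
  have h3 : covAlong F Γ' (fun x => fderiv ℝ F x (J x (V x))) y u
      = Complex.I • covAlong F Γ' (fun x => fderiv ℝ F x (V x)) y u := by
    rw [covAlong, covAlong, hev.fderiv_eq, fderiv_fun_const_smul (hF1.clm_apply hVd),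
      H.cr y hy _ (hθ y hy), H.Γ'_I y hy, smul_add]
    rfl
  have hpar : θ y (covAlong (fun x => x) Γ V y u) = 0 :=
    H.θ_parallel y hy V u hVd (by
      filter_upwards [H.isOpen.mem_nhds hy] with x hx using hθ x hx)
  rw [h1, h2, H.J_parallel y hy V u hVd, H.cr y hy _ hpar, smul_add] at h3
  exact add_left_cancel h3

/-- The failure of symmetry of the second fundamental form is the torsion. -/
lemma hessian_sub_flip (hy : y ∈ U) (u v : E) :
    hessianAlong F Γ' Γ y u v - hessianAlong F Γ' Γ y v u
      = -fderiv ℝ F y (Γ y v u - Γ y u v) := by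
  have hs := ((H.smooth_F y hy).isSymmSndFDerivAt minSmoothness_two_le_infty).eq u v
  simp only [hessianAlong, hs, H.Γ'_symm y hy (fderiv ℝ F y v), map_sub]
  abel

lemma hessian_sub_flip_horizontal (hy : y ∈ U) {u v : E} (hu : θ y u = 0) (hv : θ y v = 0) :
    hessianAlong F Γ' Γ y u v - hessianAlong F Γ' Γ y v u
      = -(g (F y) (Complex.I • fderiv ℝ F y u) (fderiv ℝ F y v) • fderiv ℝ F y (T y)) := by
  rw [H.hessian_sub_flip hy, H.torsion y hy u v hu hv, map_smul]

/-- `⟨II(u, v), w⟩` is skew in the horizontal vectors `v`, `w`, both connections being metric. -/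
lemma hessian_skew (hy : y ∈ U) (u : E) {v w : E} (hv : θ y v = 0) (hw : θ y w = 0) :
    g (F y) (hessianAlong F Γ' Γ y u v) (fderiv ℝ F y w)
      + g (F y) (fderiv ℝ F y v) (hessianAlong F Γ' Γ y u w) = 0 := by
  obtain ⟨V, rfl, hV, hVθ⟩ := H.exists_horizontal hv
  obtain ⟨W, rfl, hW, hWθ⟩ := H.exists_horizontal hw
  have hVd := (hV y hy).differentiableAt (by simp)
  have hWd := (hW y hy).differentiableAt (by simp)
  have hF := H.smooth_F y hy
  have hF1 := hF.differentiableAt_fderiv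
  have h1 := H.metric_fderiv hy (hF1.clm_apply hVd) (hF1.clm_apply hWd) u
  have h2 := H.levi_parallel y hy V W u hVd hWd
  have hev : (fun x => g (F x) (Complex.I • fderiv ℝ F x (V x)) (fderiv ℝ F x (J x (W x))))
      =ᶠ[𝓝 y] fun x => g (F x) (fderiv ℝ F x (V x)) (fderiv ℝ F x (W x)) := by
    filter_upwards [H.isOpen.mem_nhds hy] with x hx
    exact H.levi_eq hx _ (hWθ x hx)
  have hpar : θ y (covAlong (fun x => x) Γ W y u) = 0 :=
    H.θ_parallel y hy W u hWd (by
      filter_upwards [H.isOpen.mem_nhds hy] with x hx using hWθ x hx)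
  rw [hev.fderiv_eq, h1, covAlong_fderiv_apply (Γ := Γ) hF hVd,
    covAlong_fderiv_apply (Γ := Γ) hF hWd, H.levi_eq hy _ hw, H.levi_eq hy _ hpar] at h2
  simp only [map_add, add_apply] at h2
  linarith

/-- The second fundamental form of horizontal vectors is orthogonal to the horizontal space:
`⟨II(u, v), w⟩` is symmetric in `u`, `v` and skew in `v`, `w`. -/
lemma hessian_orthogonal (hy : y ∈ U) {u v w : E} (hu : θ y u = 0) (hv : θ y v = 0)
    (hw : θ y w = 0) : g (F y) (hessianAlong F Γ' Γ y u v) (fderiv ℝ F y w) = 0 := by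
  have sk : ∀ {a b c : E}, θ y a = 0 → θ y b = 0 → θ y c = 0 →
      g (F y) (hessianAlong F Γ' Γ y a b) (fderiv ℝ F y c)
        = -g (F y) (hessianAlong F Γ' Γ y a c) (fderiv ℝ F y b) := by
    intro a b c _ hb hc
    have := H.hessian_skew hy a hb hc
    rw [H.g_symm y hy (fderiv ℝ F y b)] at this
    linarith
  have sy : ∀ {a b c : E}, θ y a = 0 → θ y b = 0 → θ y c = 0 →
      g (F y) (hessianAlong F Γ' Γ y a b) (fderiv ℝ F y c)
        = g (F y) (hessianAlong F Γ' Γ y b a) (fderiv ℝ F y c) := by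
    intro a b c ha hb hc
    rw [eq_add_of_sub_eq (H.hessian_sub_flip_horizontal hy ha hb)]
    simp [H.fderiv_T_orthogonal hy hc]
  have e1 := sk hu hv hw
  have e2 := sy hu hw hv
  have e3 := sk hw hu hv
  have e4 := sy hw hv hu
  have e5 := sk hv hw hu
  have e6 := sy hv hu hw
  linarith

lemma hessian_T (hy : y ∈ U) (u : E) {w : E} (hw : θ y w = 0) :
    g (F y) (hessianAlong F Γ' Γ y u (T y)) (fderiv ℝ F y w)
      = -g (F y) (fderiv ℝ F y (T y)) (hessianAlong F Γ' Γ y u w) := by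
  obtain ⟨W, rfl, hW, hWθ⟩ := H.exists_horizontal hw
  have hTd := (H.smooth_T y hy).differentiableAt (by simp)
  have hWd := (hW y hy).differentiableAt (by simp)
  have hF := H.smooth_F y hy
  have hF1 := hF.differentiableAt_fderiv
  have h1 := H.metric_fderiv hy (hF1.clm_apply hTd) (hF1.clm_apply hWd) u
  have hev : (fun x => g (F x) (fderiv ℝ F x (T x)) (fderiv ℝ F x (W x))) =ᶠ[𝓝 y]
      fun _ => 0 := by
    filter_upwards [H.isOpen.mem_nhds hy] with x hx
    exact H.fderiv_T_orthogonal hx (hWθ x hx)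
  have hpar : θ y (covAlong (fun x => x) Γ W y u) = 0 :=
    H.θ_parallel y hy W u hWd (by
      filter_upwards [H.isOpen.mem_nhds hy] with x hx using hWθ x hx)
  rw [hev.fderiv_eq, covAlong_fderiv_apply (Γ := Γ) hF hTd,
    covAlong_fderiv_apply (Γ := Γ) hF hWd, H.T_parallel y hy] at h1
  simp only [map_add, map_zero, zero_add, H.fderiv_T_orthogonal hy hpar, fderiv_fun_const,
    Pi.zero_apply, zero_apply] at h1
  linarith

/-- The pseudohermitian torsion `τ z = Γ(T, z) - Γ(z, T)` in terms of the second fundamental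
form. -/
lemma torsion_T (hy : y ∈ U) (z : E) {w : E} (hw : θ y w = 0) :
    g (F y) (hessianAlong F Γ' Γ y (T y) z) (fderiv ℝ F y w)
      = -g (F y) (fderiv ℝ F y (T y)) (hessianAlong F Γ' Γ y z w)
        - g (F y) (fderiv ℝ F y (Γ y z (T y) - Γ y (T y) z)) (fderiv ℝ F y w) := by
  rw [eq_add_of_sub_eq (H.hessian_sub_flip hy (T y) z), ← H.hessian_T hy z hw]
  simp only [map_add, map_neg, add_apply, neg_apply]
  ring

/-- The equation of Gauß for real horizontal vectors. The last summand arises because the bracket of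
horizontal fields `A`, `B` has the component `-dθ(A, B)` along the Reeb field. -/
lemma gauss (hy : y ∈ U) {a b c d : E} (ha : θ y a = 0) (hb : θ y b = 0) (hc : θ y c = 0)
    (hd : θ y d = 0) :
    g (F y) (christoffelCurvature Γ' (F y) (fderiv ℝ F y a) (fderiv ℝ F y b) (fderiv ℝ F y c))
        (fderiv ℝ F y d)
      = g (F y) (fderiv ℝ F y (christoffelCurvature Γ y a b c)) (fderiv ℝ F y d)
        - g (F y) (hessianAlong F Γ' Γ y b c) (hessianAlong F Γ' Γ y a d)
        + g (F y) (hessianAlong F Γ' Γ y a c) (hessianAlong F Γ' Γ y b d)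
        + g (F y) (Complex.I • fderiv ℝ F y a) (fderiv ℝ F y b)
          * g (F y) (hessianAlong F Γ' Γ y (T y) c) (fderiv ℝ F y d) := by
  obtain ⟨A, rfl, hA, hAθ⟩ := H.exists_horizontal ha
  obtain ⟨B, rfl, hB, hBθ⟩ := H.exists_horizontal hb
  obtain ⟨C, rfl, hC, hCθ⟩ := H.exists_horizontal hc
  obtain ⟨D, rfl, hD, hDθ⟩ := H.exists_horizontal hd
  have hF := H.smooth_F y hy
  have hUy := H.isOpen.mem_nhds hy
  have par : ∀ {V : E → E}, (∀ x ∈ U, ContDiffAt ℝ ∞ V x) → (∀ x ∈ U, θ x (V x) = 0) →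
      ∀ x ∈ U, ∀ u, θ x (covAlong (fun x => x) Γ V x u) = 0 := by
    intro V hV hVθ x hx u
    refine H.θ_parallel x hx V u ((hV x hx).differentiableAt (by simp)) ?_
    filter_upwards [H.isOpen.mem_nhds hx] with z hz using hVθ z hz
  have dfV : ∀ {V : E → E}, (∀ x ∈ U, ContDiffAt ℝ ∞ V x) → ∀ x ∈ U,
      ContDiffAt ℝ ∞ (fun x => fderiv ℝ F x (V x)) x := fun hV x hx =>
    ((H.smooth_F x hx).fderiv_right (m := ∞) (by simp)).clm_apply (hV x hx)
  have smCov : ∀ {V W : E → E}, (∀ x ∈ U, ContDiffAt ℝ ∞ V x) → (∀ x ∈ U, ContDiffAt ℝ ∞ W x) →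
      ContDiffAt ℝ ∞ (fun x => covAlong (fun x => x) Γ V x (W x)) y := by
    intro V W hV hW
    simp only [covAlong_id]
    have := (hV y hy).fderiv_right (m := ∞) (by simp)
    have := hV y hy
    have := hW y hy
    have := H.smooth_Γ y hy
    fun_prop
  have smCov' : ∀ {W : E → E} {w : E → E'}, ContDiffAt ℝ ∞ w y → (∀ x ∈ U, ContDiffAt ℝ ∞ W x) →
      ContDiffAt ℝ ∞ (fun x => covAlong F Γ' w x (W x)) y := by
    intro W w hw hW
    unfold covAlong
    have := hw.fderiv_right (m := ∞) (by simp)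
    have := hF.fderiv_right (m := ∞) (by simp)
    have := hW y hy
    have : ContDiffAt ℝ ∞ (fun x => Γ' (F x)) y := (H.smooth_Γ' y hy).comp y hF
    exact (ContDiffAt.clm_apply ‹_› ‹_›).add
      ((this.clm_apply hw).clm_apply (ContDiffAt.clm_apply ‹_› ‹_›))
  -- Differentiate `⟨II(b, c), d⟩ = 0` and the Gauss formula for `b`, `c`.
  have step : ∀ {A B : E → E}, (∀ x ∈ U, ContDiffAt ℝ ∞ A x) → (∀ x ∈ U, θ x (A x) = 0) →
      (∀ x ∈ U, ContDiffAt ℝ ∞ B x) → (∀ x ∈ U, θ x (B x) = 0) →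
      g (F y) (covAlong F Γ' (fun x => covAlong F Γ' (fun x => fderiv ℝ F x (C x)) x (B x)) y
          (A y)) (fderiv ℝ F y (D y))
        = g (F y) (fderiv ℝ F y (covAlong (fun x => x) Γ
            (fun x => covAlong (fun x => x) Γ C x (B x)) y (A y))) (fderiv ℝ F y (D y))
          - g (F y) (hessianAlong F Γ' Γ y (B y) (C y)) (hessianAlong F Γ' Γ y (A y) (D y)) := by
    intro A B hA hAθ hB hBθ
    have hDd := (hD y hy).differentiableAt (by simp)
    have hF1 := hF.differentiableAt_fderiv
    have s1 := (smCov hC hB).differentiableAt (by simp)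
    have s2 : DifferentiableAt ℝ (fun x => fderiv ℝ F x (covAlong (fun x => x) Γ C x (B x))) y :=
      hF1.clm_apply s1
    have s3 := (smCov' (dfV hC y hy) hB).differentiableAt (by simp)
    set β : E → E' := fun x => hessianAlong F Γ' Γ x (B x) (C x) with hβ
    have hev : (fun x => covAlong F Γ' (fun x => fderiv ℝ F x (C x)) x (B x)) =ᶠ[𝓝 y]
        fun x => fderiv ℝ F x (covAlong (fun x => x) Γ C x (B x)) + β x := by
      filter_upwards [hUy] with x hx
      exact covAlong_fderiv_apply (H.smooth_F x hx) ((hC x hx).differentiableAt (by simp)) _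
    have hβd : DifferentiableAt ℝ β y := by
      refine (s3.sub s2).congr_of_eventuallyEq ?_
      filter_upwards [hev] with x hx
      rw [Pi.sub_apply, hx]; abel
    have e1 : covAlong F Γ' (fun x => covAlong F Γ' (fun x => fderiv ℝ F x (C x)) x (B x)) y (A y)
        = covAlong F Γ' (fun x => fderiv ℝ F x (covAlong (fun x => x) Γ C x (B x))) y (A y)
          + covAlong F Γ' β y (A y) := by
      rw [← covAlong_add s2 hβd]
      exact congrArg₂ (· + ·) (by rw [hev.fderiv_eq]) (by rw [hev.self_of_nhds])
    have e2 := H.metric_fderiv hy hβd (hF1.clm_apply hDd) (A y)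
    have hev2 : (fun x => g (F x) (β x) (fderiv ℝ F x (D x))) =ᶠ[𝓝 y] fun _ => 0 := by
      filter_upwards [hUy] with x hx
      exact H.hessian_orthogonal hx (hBθ x hx) (hCθ x hx) (hDθ x hx)
    rw [hev2.fderiv_eq, covAlong_fderiv_apply (Γ := Γ) hF hDd] at e2
    rw [e1, covAlong_fderiv_apply (Γ := Γ) hF s1]
    simp only [map_add, add_apply, fderiv_fun_const,
      Pi.zero_apply, zero_apply, hβ,
      H.hessian_orthogonal hy (hBθ y hy) (hCθ y hy) (par hD hDθ y hy _),
      H.hessian_orthogonal hy (hAθ y hy) (par hC hCθ y hy _) hd] at e2 ⊢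
    linarith
  have hAd := (hA y hy).differentiableAt (by simp)
  have hBd := (hB y hy).differentiableAt (by simp)
  have c1 := covAlong_comm hF ((H.smooth_Γ' y hy).differentiableAt (by simp)) (dfV hC y hy) hAd hBd
  have c2 := covAlong_comm (F := fun x : E => x) (Γ' := Γ) (y := y) contDiffAt_id
    ((H.smooth_Γ y hy).differentiableAt (by simp)) (hC y hy) hAd hBd
  simp only [fderiv_fun_id, ContinuousLinearMap.id_apply] at c2
  rw [covAlong_fderiv_apply (Γ := Γ) hF ((hC y hy).differentiableAt (by simp))] at c1
  -- The bracket of `A` and `B` is `∇_A B - ∇_B A` minus the torsion.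
  have hbr : fderiv ℝ B y (A y) - fderiv ℝ A y (B y)
      = covAlong (fun x => x) Γ B y (A y) - covAlong (fun x => x) Γ A y (B y)
        - g (F y) (Complex.I • fderiv ℝ F y (A y)) (fderiv ℝ F y (B y)) • T y := by
    rw [← H.torsion y hy _ _ ha hb, covAlong_id, covAlong_id]; abel
  have hadd : ∀ u₁ u₂ v, hessianAlong F Γ' Γ y (u₁ - u₂) v
      = hessianAlong F Γ' Γ y u₁ v - hessianAlong F Γ' Γ y u₂ v := by
    intros; simp [hessianAlong]; abel
  have hsmul : ∀ (r : ℝ) u v, hessianAlong F Γ' Γ y (r • u) v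
      = r • hessianAlong F Γ' Γ y u v := by
    intros; simp [hessianAlong, smul_sub]
  have e1 := step hA hAθ hB hBθ
  have e2 := step hB hBθ hA hAθ
  have e3 := congrArg (fun u => g (F y) u (fderiv ℝ F y (D y))) c1
  have e4 := congrArg (fun u => g (F y) (fderiv ℝ F y u) (fderiv ℝ F y (D y))) c2
  have e5 : g (F y) (hessianAlong F Γ' Γ y (fderiv ℝ B y (A y) - fderiv ℝ A y (B y)) (C y))
      (fderiv ℝ F y (D y)) = -(g (F y) (Complex.I • fderiv ℝ F y (A y)) (fderiv ℝ F y (B y))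
          * g (F y) (hessianAlong F Γ' Γ y (T y) (C y)) (fderiv ℝ F y (D y))) := by
    rw [hbr, hadd, hadd, hsmul]
    simp [H.hessian_orthogonal hy (par hB hBθ y hy _) hc hd,
      H.hessian_orthogonal hy (par hA hAθ y hy _) hc hd]
  simp only [map_add, map_sub, add_apply, sub_apply]
    at e3 e4 e5
  linarith

end IsLocalPseudohermitianSubmanifold

end LocalGauss

/-! ### Vector fields in charts -/

lemma contDiffAt_of_clm_apply {E F G : Type*} [NormedAddCommGroup E] [NormedSpace ℝ E]
    [FiniteDimensional ℝ E] [NormedAddCommGroup F] [NormedSpace ℝ F] [NormedAddCommGroup G]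
    [NormedSpace ℝ G] {f : G → E →L[ℝ] F} {y : G} (h : ∀ a, ContDiffAt ℝ ∞ (fun z => f z a) y) :
    ContDiffAt ℝ ∞ f y := by
  set b := Module.finBasis ℝ E
  have : f = fun z => ∑ i, (LinearMap.toContinuousLinearMap (b.coord i)).smulRight (f z (b i)) := by
    funext z
    ext v
    conv_lhs => rw [← b.sum_repr v, map_sum]
    simp
  rw [this]
  exact ContDiffAt.sum fun i _ => contDiffAt_const.smulRight (h (b i))

section Chart

variable {E : Type*} [NormedAddCommGroup E] [NormedSpace ℝ E]
  {M : Type*} [TopologicalSpace M] [ChartedSpace E M] [IsManifold 𝓘(ℝ, E) ∞ M]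

/-- The identification of the model space with the tangent space at `q` given by the preferred chart
at `p`. For fixed `a`, the vector field `q ↦ frame p q a` is a coordinate field of this chart. -/
def frame (p q : M) : E →L[ℝ] TangentSpace 𝓘(ℝ, E) q :=
  (trivializationAt E (TangentSpace 𝓘(ℝ, E)) p).symmL ℝ q

/-- The components of a tangent vector at `q` in the preferred chart at `p`. -/
def coframe (p q : M) : TangentSpace 𝓘(ℝ, E) q →L[ℝ] E :=
  (trivializationAt E (TangentSpace 𝓘(ℝ, E)) p).continuousLinearMapAt ℝ q

/-- The components, as a function on the model space, of a vector field `V` in the preferred chart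
at `p`. -/
def components (p : M) (V : ∀ q : M, TangentSpace 𝓘(ℝ, E) q) (y : E) : E :=
  coframe p ((extChartAt 𝓘(ℝ, E) p).symm y) (V ((extChartAt 𝓘(ℝ, E) p).symm y))

variable {p q : M}

lemma mem_baseSet (hq : q ∈ (extChartAt 𝓘(ℝ, E) p).source) :
    q ∈ (trivializationAt E (TangentSpace 𝓘(ℝ, E)) p).baseSet := by
  simpa using hq

lemma coframe_frame (hq : q ∈ (extChartAt 𝓘(ℝ, E) p).source) (a : E) :
    coframe p q (frame p q a) = a :=
  (trivializationAt E (TangentSpace 𝓘(ℝ, E)) p).continuousLinearMapAt_symmL (mem_baseSet hq) a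

lemma frame_coframe (hq : q ∈ (extChartAt 𝓘(ℝ, E) p).source) (v : TangentSpace 𝓘(ℝ, E) q) :
    frame p q (coframe p q v) = v :=
  (trivializationAt E (TangentSpace 𝓘(ℝ, E)) p).symmL_continuousLinearMapAt (mem_baseSet hq) v

lemma coframe_apply (hq : q ∈ (extChartAt 𝓘(ℝ, E) p).source) (v : TangentSpace 𝓘(ℝ, E) q) :
    coframe p q v = (trivializationAt E (TangentSpace 𝓘(ℝ, E)) p ⟨q, v⟩).2 := by
  rw [coframe, Trivialization.continuousLinearMapAt_apply,
    Trivialization.linearMapAt_apply, if_pos (mem_baseSet hq)]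

lemma extend_eq_frame (hq : q ∈ (extChartAt 𝓘(ℝ, E) p).source) (v : TangentSpace 𝓘(ℝ, E) p) :
    extend E v q = frame p q (coframe p p v) := by
  rw [coframe_apply (mem_extChartAt_source p)]
  exact (Trivialization.symmL_apply _ (mem_baseSet hq) _).symm

lemma frame_eq_mfderiv (hq : q ∈ (extChartAt 𝓘(ℝ, E) p).source) :
    frame (E := E) p q = mfderiv 𝓘(ℝ, E) 𝓘(ℝ, E) (extChartAt 𝓘(ℝ, E) p).symm
      (extChartAt 𝓘(ℝ, E) p q) := by
  have h := TangentBundle.symmL_trivializationAt (I := 𝓘(ℝ, E)) (x₀ := p) (x := q)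
    (by simpa using hq)
  unfold frame
  rw [h, ← mfderivWithin_univ, ModelWithCorners.range_eq_univ]

lemma coframe_eq_mfderiv (hq : q ∈ (extChartAt 𝓘(ℝ, E) p).source) :
    coframe (E := E) p q = mfderiv 𝓘(ℝ, E) 𝓘(ℝ, E) (extChartAt 𝓘(ℝ, E) p) q :=
  TangentBundle.continuousLinearMapAt_trivializationAt (I := 𝓘(ℝ, E)) (by simpa using hq)

/-- Coordinate fields differentiate functions by partial derivatives. -/
lemma mvfderiv_frame {G : Type*} [NormedAddCommGroup G] [NormedSpace ℝ G] {f : M → G}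
    (hq : q ∈ (extChartAt 𝓘(ℝ, E) p).source) (hf : MDifferentiableAt 𝓘(ℝ, E) 𝓘(ℝ, G) f q) (a : E) :
    mvfderiv 𝓘(ℝ, E) f q (frame (E := E) p q a)
      = fderiv ℝ (f ∘ (extChartAt 𝓘(ℝ, E) p).symm) (extChartAt 𝓘(ℝ, E) p q) a := by
  have hinv : (extChartAt 𝓘(ℝ, E) p).symm (extChartAt 𝓘(ℝ, E) p q) = q :=
    (extChartAt 𝓘(ℝ, E) p).left_inv hq
  have hψ : MDifferentiableAt 𝓘(ℝ, E) 𝓘(ℝ, E) (extChartAt 𝓘(ℝ, E) p).symm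
      (extChartAt 𝓘(ℝ, E) p q) := by
    have := mdifferentiableWithinAt_extChartAt_symm (I := 𝓘(ℝ, E))
      ((extChartAt 𝓘(ℝ, E) p).map_source hq)
    rwa [ModelWithCorners.range_eq_univ, mdifferentiableWithinAt_univ] at this
  have h := mfderiv_comp_apply_of_eq (f := (extChartAt 𝓘(ℝ, E) p).symm) (g := f) _ hf hψ hinv a
  rw [mfderiv_eq_fderiv] at h
  rw [frame_eq_mfderiv hq]
  exact h.symm

lemma contMDiffAt_symm (hq : q ∈ (extChartAt 𝓘(ℝ, E) p).source) :
    ContMDiffAt 𝓘(ℝ, E) 𝓘(ℝ, E) ∞ (extChartAt 𝓘(ℝ, E) p).symm (extChartAt 𝓘(ℝ, E) p q) :=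
  (contMDiffOn_extChartAt_symm (I := 𝓘(ℝ, E)) (n := ∞) p).contMDiffAt
    ((isOpen_extChartAt_target p).mem_nhds ((extChartAt 𝓘(ℝ, E) p).map_source hq))

lemma contMDiffAt_chart (hq : q ∈ (extChartAt 𝓘(ℝ, E) p).source) :
    ContMDiffAt 𝓘(ℝ, E) 𝓘(ℝ, E) ∞ (extChartAt 𝓘(ℝ, E) p) q :=
  contMDiffAt_extChartAt' (by simpa using hq)

omit [IsManifold 𝓘(ℝ, E) ∞ M] in
lemma source_mem_nhds (hq : q ∈ (extChartAt 𝓘(ℝ, E) p).source) :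
    (extChartAt 𝓘(ℝ, E) p).source ∈ 𝓝 q :=
  (isOpen_extChartAt_source p).mem_nhds hq

lemma tendsto_symm (hq : q ∈ (extChartAt 𝓘(ℝ, E) p).source) :
    Filter.Tendsto (extChartAt 𝓘(ℝ, E) p).symm (𝓝 (extChartAt 𝓘(ℝ, E) p q)) (𝓝 q) := by
  have := (contMDiffAt_symm hq).continuousAt
  rwa [ContinuousAt, (extChartAt 𝓘(ℝ, E) p).left_inv hq] at this

/-- Smoothness of a function read in a chart. -/
lemma contDiffAt_comp_symm {G : Type*} [NormedAddCommGroup G] [NormedSpace ℝ G] {f : M → G}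
    (hq : q ∈ (extChartAt 𝓘(ℝ, E) p).source) (hf : ContMDiffAt 𝓘(ℝ, E) 𝓘(ℝ, G) ∞ f q) :
    ContDiffAt ℝ ∞ (f ∘ (extChartAt 𝓘(ℝ, E) p).symm) (extChartAt 𝓘(ℝ, E) p q) := by
  rw [← contMDiffAt_iff_contDiffAt]
  exact hf.comp_of_eq (contMDiffAt_symm hq) ((extChartAt 𝓘(ℝ, E) p).left_inv hq)

lemma differentiableAt_comp_symm {G : Type*} [NormedAddCommGroup G] [NormedSpace ℝ G] {f : M → G}
    (hq : q ∈ (extChartAt 𝓘(ℝ, E) p).source) (hf : MDifferentiableAt 𝓘(ℝ, E) 𝓘(ℝ, G) f q) :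
    DifferentiableAt ℝ (f ∘ (extChartAt 𝓘(ℝ, E) p).symm) (extChartAt 𝓘(ℝ, E) p q) := by
  rw [← mdifferentiableAt_iff_differentiableAt]
  exact MDifferentiableAt.comp_of_eq _ hf ((contMDiffAt_symm hq).mdifferentiableAt (by simp))
    ((extChartAt 𝓘(ℝ, E) p).left_inv hq)

lemma tendsto_chart (hq : q ∈ (extChartAt 𝓘(ℝ, E) p).source) :
    Filter.Tendsto (extChartAt 𝓘(ℝ, E) p) (𝓝 q) (𝓝 (extChartAt 𝓘(ℝ, E) p q)) :=
  (contMDiffAt_chart hq).continuousAt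

/-- The derivative of a function along a coordinate field is the partial derivative of its
expression in the chart. -/
lemma mvfderiv_frame_of_eventuallyEq {f : M → ℝ} {f' : E → ℝ}
    (hq : q ∈ (extChartAt 𝓘(ℝ, E) p).source)
    (hf' : DifferentiableAt ℝ f' (extChartAt 𝓘(ℝ, E) p q))
    (h : ∀ᶠ z in 𝓝 q, f z = f' (extChartAt 𝓘(ℝ, E) p z)) (a : E) :
    mvfderiv 𝓘(ℝ, E) f q (frame (E := E) p q a) = fderiv ℝ f' (extChartAt 𝓘(ℝ, E) p q) a := by
  have hm : MDifferentiableAt 𝓘(ℝ, E) 𝓘(ℝ, ℝ) f q :=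
    (MDifferentiableAt.comp q hf'.mdifferentiableAt
      ((contMDiffAt_chart hq).mdifferentiableAt (by simp))).congr_of_eventuallyEq h
  rw [mvfderiv_frame hq hm]
  congr 1
  refine Filter.EventuallyEq.fderiv_eq ?_
  filter_upwards [(tendsto_symm hq).eventually h,
    (isOpen_extChartAt_target p).mem_nhds ((extChartAt 𝓘(ℝ, E) p).map_source hq)] with y h1 h2
  rw [Function.comp_apply, h1, (extChartAt 𝓘(ℝ, E) p).right_inv h2]

lemma smoothFieldAt_iff {V : ∀ q : M, TangentSpace 𝓘(ℝ, E) q}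
    (hq : q ∈ (extChartAt 𝓘(ℝ, E) p).source) :
    SmoothFieldAt V q ↔ ContMDiffAt 𝓘(ℝ, E) 𝓘(ℝ, E) ∞ (fun x => coframe (E := E) p x (V x)) q := by
  rw [SmoothFieldAt, (trivializationAt E (TangentSpace 𝓘(ℝ, E)) p).contMDiffAt_section_iff
    (mem_baseSet hq)]
  refine Filter.EventuallyEq.contMDiffAt_iff ?_
  filter_upwards [source_mem_nhds hq] with x hx
  exact (coframe_apply hx _).symm

lemma diffFieldAt_iff {V : ∀ q : M, TangentSpace 𝓘(ℝ, E) q}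
    (hq : q ∈ (extChartAt 𝓘(ℝ, E) p).source) :
    DiffFieldAt V q ↔
      MDifferentiableAt 𝓘(ℝ, E) 𝓘(ℝ, E) (fun x => coframe (E := E) p x (V x)) q := by
  have h := (trivializationAt E (TangentSpace 𝓘(ℝ, E)) p).mdifferentiableAt_section_iff
    𝓘(ℝ, E) V (mem_baseSet hq)
  refine h.trans (Filter.EventuallyEq.mdifferentiableAt_iff ?_)
  filter_upwards [source_mem_nhds hq] with x hx
  exact (coframe_apply hx _).symm

lemma SmoothFieldAt.components {V : ∀ q : M, TangentSpace 𝓘(ℝ, E) q} (hV : SmoothFieldAt V q)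
    (hq : q ∈ (extChartAt 𝓘(ℝ, E) p).source) :
    ContDiffAt ℝ ∞ (components p V) (extChartAt 𝓘(ℝ, E) p q) :=
  contDiffAt_comp_symm hq ((smoothFieldAt_iff hq).1 hV)

lemma DiffFieldAt.components {V : ∀ q : M, TangentSpace 𝓘(ℝ, E) q} (hV : DiffFieldAt V q)
    (hq : q ∈ (extChartAt 𝓘(ℝ, E) p).source) :
    DifferentiableAt ℝ (components p V) (extChartAt 𝓘(ℝ, E) p q) :=
  differentiableAt_comp_symm hq ((diffFieldAt_iff hq).1 hV)

/-- The vector field with components `v` in the preferred chart at `p`. -/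
def fieldOf (p : M) (v : E → E) (q : M) : TangentSpace 𝓘(ℝ, E) q :=
  frame (E := E) p q (v (extChartAt 𝓘(ℝ, E) p q))

lemma smoothFieldAt_fieldOf {v : E → E} (hq : q ∈ (extChartAt 𝓘(ℝ, E) p).source)
    (hv : ContDiffAt ℝ ∞ v (extChartAt 𝓘(ℝ, E) p q)) : SmoothFieldAt (fieldOf p v) q := by
  rw [smoothFieldAt_iff hq]
  refine ContMDiffAt.congr_of_eventuallyEq (hv.contMDiffAt.comp q (contMDiffAt_chart hq)) ?_
  filter_upwards [source_mem_nhds hq] with x hx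
  exact coframe_frame hx _

lemma diffFieldAt_fieldOf {v : E → E} (hq : q ∈ (extChartAt 𝓘(ℝ, E) p).source)
    (hv : DifferentiableAt ℝ v (extChartAt 𝓘(ℝ, E) p q)) : DiffFieldAt (fieldOf p v) q := by
  rw [diffFieldAt_iff hq]
  refine MDifferentiableAt.congr_of_eventuallyEq (MDifferentiableAt.comp q hv.mdifferentiableAt
    ((contMDiffAt_chart hq).mdifferentiableAt (by simp))) ?_
  filter_upwards [source_mem_nhds hq] with x hx
  exact coframe_frame hx _

lemma fieldOf_components {V : ∀ q : M, TangentSpace 𝓘(ℝ, E) q}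
    (hq : q ∈ (extChartAt 𝓘(ℝ, E) p).source) : fieldOf p (components p V) q = V q := by
  rw [fieldOf, components, (extChartAt 𝓘(ℝ, E) p).left_inv hq, frame_coframe hq]

lemma components_extend (v : TangentSpace 𝓘(ℝ, E) p) {y : E}
    (hy : y ∈ (extChartAt 𝓘(ℝ, E) p).target) : components p (extend E v) y = coframe p p v := by
  have := (extChartAt 𝓘(ℝ, E) p).map_target hy
  rw [components, extend_eq_frame this, coframe_frame this]

lemma diffFieldAt_extend (v : TangentSpace 𝓘(ℝ, E) p)
    (hq : q ∈ (extChartAt 𝓘(ℝ, E) p).source) : DiffFieldAt (extend E v) q := by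
  rw [diffFieldAt_iff hq]
  refine MDifferentiableAt.congr_of_eventuallyEq (mdifferentiableAt_const (c := coframe p p v)) ?_
  filter_upwards [source_mem_nhds hq] with x hx
  rw [extend_eq_frame hx, coframe_frame hx]

/-- Coordinate fields commute. -/
lemma mlieBracket_frame [CompleteSpace E] (hq : q ∈ (extChartAt 𝓘(ℝ, E) p).source) (a b : E) :
    mlieBracket 𝓘(ℝ, E) (fun x => frame (E := E) p x a) (fun x => frame (E := E) p x b) q = 0 := by
  have : IsManifold 𝓘(ℝ, E) (minSmoothness ℝ 2) M := IsManifold.of_le minSmoothness_two_le_infty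
  set y := extChartAt 𝓘(ℝ, E) p q with hy
  have hψq : (extChartAt 𝓘(ℝ, E) p).symm y = q := (extChartAt 𝓘(ℝ, E) p).left_inv hq
  have hd : ∀ a : E, DiffFieldAt (fun x => frame (E := E) p x a) q := fun a =>
    diffFieldAt_fieldOf (v := fun _ => a) hq (by fun_prop)
  have hinv : ∀ z ∈ (extChartAt 𝓘(ℝ, E) p).target,
      mfderiv 𝓘(ℝ, E) 𝓘(ℝ, E) (extChartAt 𝓘(ℝ, E) p).symm z
        = frame (E := E) p ((extChartAt 𝓘(ℝ, E) p).symm z) := by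
    intro z hz
    have h := frame_eq_mfderiv ((extChartAt 𝓘(ℝ, E) p).map_target hz)
    rw [(extChartAt 𝓘(ℝ, E) p).right_inv hz] at h
    exact h.symm
  have hI : ∀ z ∈ (extChartAt 𝓘(ℝ, E) p).target,
      (mfderiv 𝓘(ℝ, E) 𝓘(ℝ, E) (extChartAt 𝓘(ℝ, E) p).symm z).inverse
        = coframe (E := E) p ((extChartAt 𝓘(ℝ, E) p).symm z) := by
    intro z hz
    have hz' := (extChartAt 𝓘(ℝ, E) p).map_target hz
    refine ContinuousLinearMap.inverse_eq ?_ ?_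
    · rw [hinv z hz]; ext v; exact frame_coframe hz' v
    · rw [hinv z hz]; ext v; exact coframe_frame hz' v
  have hpull : ∀ a : E, mpullback 𝓘(ℝ, E) 𝓘(ℝ, E) (extChartAt 𝓘(ℝ, E) p).symm
      (fun x => frame (E := E) p x a) =ᶠ[𝓝 y] fun _ => a := by
    intro a
    filter_upwards [(isOpen_extChartAt_target p).mem_nhds ((extChartAt 𝓘(ℝ, E) p).map_source hq)]
      with z hz
    rw [mpullback_apply, hI z hz]
    exact coframe_frame ((extChartAt 𝓘(ℝ, E) p).map_target hz) a
  have h := mpullback_mlieBracket (I := 𝓘(ℝ, E)) (I' := 𝓘(ℝ, E)) (n := ∞)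
    (f := (extChartAt 𝓘(ℝ, E) p).symm)
    (V := fun x => frame (E := E) p x a) (W := fun x => frame (E := E) p x b) (x₀ := y)
    (by rw [hψq]; exact hd a) (by rw [hψq]; exact hd b) (contMDiffAt_symm hq)
    minSmoothness_two_le_infty
  rw [(hpull a).mlieBracket_vectorField_eq (hpull b), mpullback_apply,
    hI y ((extChartAt 𝓘(ℝ, E) p).map_source hq), hψq] at h
  have h0 : mlieBracket 𝓘(ℝ, E) (fun _ : E => a) (fun _ : E => b) y = 0 := by
    have h1 : mlieBracket 𝓘(ℝ, E) (fun _ : E => a) (fun _ : E => b) = lieBracketWithin ℝ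
        (fun _ : E => a) (fun _ : E => b) Set.univ := mlieBracketWithin_eq_lieBracketWithin
    refine (congrFun h1 y).trans ?_
    simp only [lieBracketWithin, fderivWithin_fun_const]
    exact sub_self (0 : E)
  have h2 := congrArg (frame (E := E) p q) (h.trans h0)
  exact (frame_coframe hq _).symm.trans (h2.trans (map_zero (frame (E := E) p q)))

lemma extend_eventuallyEq (hq : q ∈ (extChartAt 𝓘(ℝ, E) p).source) (v : TangentSpace 𝓘(ℝ, E) p) :
    ∀ᶠ x in 𝓝 q, extend E v x = frame p x (coframe p p v) := by
  filter_upwards [source_mem_nhds hq] with x hx using extend_eq_frame hx v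

lemma mlieBracket_extend [CompleteSpace E] (a b : TangentSpace 𝓘(ℝ, E) p)
    (hq : q ∈ (extChartAt 𝓘(ℝ, E) p).source) :
    mlieBracket 𝓘(ℝ, E) (extend E a) (extend E b) q = 0 :=
  (Filter.EventuallyEq.mlieBracket_vectorField_eq (extend_eventuallyEq hq a)
    (extend_eventuallyEq hq b)).trans (mlieBracket_frame hq _ _)

end Chart

/-! ### Connections in charts -/

section Christoffel

variable {E : Type*} [NormedAddCommGroup E] [NormedSpace ℝ E]
  {M : Type*} [TopologicalSpace M] [ChartedSpace E M] [IsManifold 𝓘(ℝ, E) ∞ M] {p q : M}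

lemma cov_sum_smul (cov : AffineConnection E M) {κ : Type*} (s : Finset κ) (f : κ → M → ℝ)
    (σ : κ → ∀ q : M, TangentSpace 𝓘(ℝ, E) q)
    (hf : ∀ i, MDifferentiableAt 𝓘(ℝ, E) 𝓘(ℝ, ℝ) (f i) q) (hσ : ∀ i, DiffFieldAt (σ i) q)
    (u : TangentSpace 𝓘(ℝ, E) q) :
    DiffFieldAt (fun x => ∑ i ∈ s, f i x • σ i x) q ∧
    cov (fun x => ∑ i ∈ s, f i x • σ i x) q u
      = ∑ i ∈ s, (f i q • cov (σ i) q u + mvfderiv 𝓘(ℝ, E) (f i) q u • σ i q) := by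
  classical
  have hd : ∀ t : Finset κ, DiffFieldAt (fun x => ∑ i ∈ t, f i x • σ i x) q := fun t =>
    MDifferentiableAt.sum_section fun i _ => (hf i).smul_section (hσ i)
  refine ⟨hd s, ?_⟩
  induction s using Finset.induction_on with
  | empty =>
    simp only [Finset.sum_empty]
    have h := cov.isCovariantDerivativeOnUniv.zero (x := q)
    exact congrArg (fun L => L u) h
  | insert i t hi ih =>
    have h1 := cov.isCovariantDerivativeOnUniv.add ((hf i).smul_section (hσ i)) (hd t)
      (Set.mem_univ q)
    have h2 := cov.isCovariantDerivativeOnUniv.leibniz (hσ i) (hf i) (Set.mem_univ q)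
    have h3 : (fun x => ∑ j ∈ insert i t, f j x • σ j x)
        = (f i • σ i) + fun x => ∑ j ∈ t, f j x • σ j x := by
      funext x; rw [Finset.sum_insert hi]; rfl
    rw [h3, Finset.sum_insert hi, ← ih]
    refine (congrArg (fun L => L u) h1).trans ?_
    refine congrArg₂ (· + ·) ((congrArg (fun L => L u) h2).trans ?_) rfl
    rfl

variable [FiniteDimensional ℝ E]

/-- The Christoffel symbols of a connection in the preferred chart at `p`, as a function on the
model space: `christoffel cov p y b a` is the covariant derivative of the coordinate field `b` in
the direction `a`. -/
def christoffel (cov : AffineConnection E M) (p : M) (y : E) : E →L[ℝ] E →L[ℝ] E :=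
  ∑ i, (LinearMap.toContinuousLinearMap ((Module.finBasis ℝ E).coord i)).smulRight
    (coframe p ((extChartAt 𝓘(ℝ, E) p).symm y)
      ∘L cov (fun x => frame p x (Module.finBasis ℝ E i)) ((extChartAt 𝓘(ℝ, E) p).symm y)
      ∘L frame p ((extChartAt 𝓘(ℝ, E) p).symm y))

lemma cov_fieldOf (cov : AffineConnection E M) (hq : q ∈ (extChartAt 𝓘(ℝ, E) p).source)
    {v : E → E} (hv : DifferentiableAt ℝ v (extChartAt 𝓘(ℝ, E) p q)) (a : E) :
    coframe p q (cov (fieldOf p v) q (frame p q a))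
      = covAlong (fun x => x) (christoffel cov p) v (extChartAt 𝓘(ℝ, E) p q) a := by
  set b := Module.finBasis ℝ E with hb
  set φ := extChartAt 𝓘(ℝ, E) p with hφ
  have hinv : φ.symm (φ q) = q := φ.left_inv hq
  let c : Fin (Module.finrank ℝ E) → E →L[ℝ] ℝ := fun i =>
    LinearMap.toContinuousLinearMap (b.coord i)
  let f : Fin (Module.finrank ℝ E) → M → ℝ := fun i x => c i (v (φ x))
  have hsum : ∀ w : E, ∑ i, c i w • b i = w := fun w => b.sum_repr w
  have h1 : fieldOf p v = fun x => ∑ i, f i x • frame (E := E) p x (b i) := by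
    funext x
    rw [fieldOf]
    conv_lhs => rw [← hsum (v (extChartAt 𝓘(ℝ, E) p x)), map_sum]
    exact Finset.sum_congr rfl fun i _ => map_smul _ _ _
  have hvφ : MDifferentiableAt 𝓘(ℝ, E) 𝓘(ℝ, E) (fun x => v (φ x)) q :=
    MDifferentiableAt.comp q hv.mdifferentiableAt
      ((contMDiffAt_chart hq).mdifferentiableAt (by simp))
  have hf : ∀ i, MDifferentiableAt 𝓘(ℝ, E) 𝓘(ℝ, ℝ) (f i) q := fun i =>
    MDifferentiableAt.comp q (c i).mdifferentiableAt hvφ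
  have hσ : ∀ i, DiffFieldAt (fun x => frame (E := E) p x (b i)) q := fun i =>
    diffFieldAt_fieldOf (v := fun _ => b i) hq (by fun_prop)
  have hdf : ∀ i, mvfderiv 𝓘(ℝ, E) (f i) q (frame p q a) = c i (fderiv ℝ v (φ q) a) := by
    intro i
    rw [mvfderiv_frame hq (hf i)]
    have : (f i ∘ φ.symm) =ᶠ[𝓝 (φ q)] fun y => c i (v y) := by
      filter_upwards [(isOpen_extChartAt_target p).mem_nhds (φ.map_source hq)] with y hy
      simp only [Function.comp_apply, f]
      rw [φ.right_inv hy]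
    rw [this.fderiv_eq]
    have := (c i).hasFDerivAt.comp (φ q) hv.hasFDerivAt
    exact congrArg (fun L => L a) this.fderiv
  rw [h1, (cov_sum_smul cov Finset.univ f _ hf hσ _).2, map_sum, covAlong_id]
  simp only [map_add, map_smul, Finset.sum_add_distrib, coframe_frame hq, hdf, hsum]
  rw [add_comm, christoffel, hinv]
  simp [f, c, b, smul_apply]

/-- The covariant derivative in the preferred chart at `p`. -/
lemma coframe_cov (cov : AffineConnection E M) (hq : q ∈ (extChartAt 𝓘(ℝ, E) p).source)
    {V : ∀ q : M, TangentSpace 𝓘(ℝ, E) q} (hV : DiffFieldAt V q) (a : E) :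
    coframe p q (cov V q (frame p q a))
      = covAlong (fun x => x) (christoffel cov p) (components p V) (extChartAt 𝓘(ℝ, E) p q) a := by
  have hd := DiffFieldAt.components hV hq
  rw [← cov_fieldOf cov hq hd, cov.isCovariantDerivativeOnUniv.congr_of_eventuallyEq
    (σ' := fieldOf p (components p V)) hV (diffFieldAt_fieldOf hq hd) Filter.univ_mem]
  filter_upwards [source_mem_nhds hq] with x hx using (fieldOf_components hx).symm

lemma coframe_cov_extend (cov : AffineConnection E M) (hq : q ∈ (extChartAt 𝓘(ℝ, E) p).source)
    (v : TangentSpace 𝓘(ℝ, E) p) (a : E) :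
    coframe p q (cov (extend E v) q (frame p q a))
      = christoffel cov p (extChartAt 𝓘(ℝ, E) p q) (coframe p p v) a := by
  have hev : components p (extend E v) =ᶠ[𝓝 (extChartAt 𝓘(ℝ, E) p q)] fun _ => coframe p p v := by
    filter_upwards [(isOpen_extChartAt_target p).mem_nhds ((extChartAt 𝓘(ℝ, E) p).map_source hq)]
      with y hy using components_extend v hy
  rw [coframe_cov cov hq (diffFieldAt_extend v hq), covAlong_id, hev.fderiv_eq, hev.self_of_nhds]
  simp

lemma contDiffAt_christoffel {cov : AffineConnection E M} (hcov : IsSmoothConnection cov)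
    (hq : q ∈ (extChartAt 𝓘(ℝ, E) p).source) :
    ContDiffAt ℝ ∞ (christoffel cov p) (extChartAt 𝓘(ℝ, E) p q) := by
  unfold christoffel
  refine ContDiffAt.sum fun i _ => ?_
  have key : ContDiffAt ℝ ∞ (fun y => coframe p ((extChartAt 𝓘(ℝ, E) p).symm y)
      ∘L cov (fun x => frame p x (Module.finBasis ℝ E i)) ((extChartAt 𝓘(ℝ, E) p).symm y)
      ∘L frame p ((extChartAt 𝓘(ℝ, E) p).symm y)) (extChartAt 𝓘(ℝ, E) p q) := by
    refine contDiffAt_of_clm_apply fun a => ?_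
    have hs : ∀ a : E, ∀ x ∈ (extChartAt 𝓘(ℝ, E) p).source,
        SmoothFieldAt (fun x => frame (E := E) p x a) x := fun a x hx =>
      smoothFieldAt_fieldOf (v := fun _ => a) hx contDiffAt_const
    have h1 := (hcov _ (isOpen_extChartAt_source (I := 𝓘(ℝ, E)) p)).contMDiff
      (σ := fun x => frame (E := E) p x (Module.finBasis ℝ E i))
      fun x hx => (hs _ x hx).contMDiffWithinAt
    have h2 := (h1 q hq).contMDiffAt (source_mem_nhds hq)
    have h3 : SmoothFieldAt (fun x => cov (fun x => frame (E := E) p x (Module.finBasis ℝ E i)) x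
        (frame (E := E) p x a)) q :=
      ContMDiffAt.clm_bundle_apply (b := fun x => x) h2 (hs a q hq)
    exact h3.components hq
  exact contDiffAt_const.smulRight key

end Christoffel

/-! ### Tensors and maps in charts -/

lemma fderiv_clm_apply_const₂ {G E₁ E₂ E₃ : Type*} [NormedAddCommGroup G] [NormedSpace ℝ G]
    [NormedAddCommGroup E₁] [NormedSpace ℝ E₁] [NormedAddCommGroup E₂] [NormedSpace ℝ E₂]
    [NormedAddCommGroup E₃] [NormedSpace ℝ E₃] {L : G → E₁ →L[ℝ] E₂ →L[ℝ] E₃} {y : G}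
    (hL : DifferentiableAt ℝ L y) (a : G) (b : E₁) (c : E₂) :
    fderiv ℝ (fun z => L z b c) y a = fderiv ℝ L y a b c := by
  rw [fderiv_clm_apply (hL.clm_apply (differentiableAt_const _)) (differentiableAt_const _),
    fderiv_clm_apply hL (differentiableAt_const _)]
  simp

section Tensors

variable {E : Type*} [NormedAddCommGroup E] [NormedSpace ℝ E] [FiniteDimensional ℝ E]
  {M : Type*} [TopologicalSpace M] [ChartedSpace E M] [IsManifold 𝓘(ℝ, E) ∞ M] {p q : M}

/-- The torsion tensor in the preferred chart at `p`. -/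
lemma coframe_torsionTensor (cov : AffineConnection E M)
    (hq : q ∈ (extChartAt 𝓘(ℝ, E) p).source) (a b : E) :
    coframe p q (torsionTensor cov q (frame p q a) (frame p q b))
      = christoffel cov p (extChartAt 𝓘(ℝ, E) p q) b a
        - christoffel cov p (extChartAt 𝓘(ℝ, E) p q) a b := by
  have : CompleteSpace E := FiniteDimensional.complete ℝ E
  have hd : ∀ a : E, DiffFieldAt (fun x => frame (E := E) p x a) q := fun a =>
    diffFieldAt_fieldOf (v := fun _ => a) hq (by fun_prop)
  have hc : ∀ a b : E, coframe p q (cov (fun x => frame (E := E) p x b) q (frame p q a))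
      = christoffel cov p (extChartAt 𝓘(ℝ, E) p q) b a := by
    intro a b
    refine (cov_fieldOf cov hq (v := fun _ => b) (by fun_prop) a).trans ?_
    simp [covAlong_id]
  have h := cov.torsion_apply (hd a) (hd b)
  rw [mlieBracket_frame hq, sub_zero] at h
  rw [torsionTensor, h, map_sub, hc, hc]

/-- The curvature tensor in the preferred chart at `p`. -/
lemma coframe_curvatureTensor {cov : AffineConnection E M} (hcov : IsSmoothConnection cov) (p : M)
    (a b c : TangentSpace 𝓘(ℝ, E) p) :
    coframe p p (curvatureTensor cov p a b c)
      = christoffelCurvature (christoffel cov p) (extChartAt 𝓘(ℝ, E) p p)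
        (coframe p p a) (coframe p p b) (coframe p p c) := by
  have : CompleteSpace E := FiniteDimensional.complete ℝ E
  have hp := mem_extChartAt_source (I := 𝓘(ℝ, E)) p
  have hev : ∀ b : TangentSpace 𝓘(ℝ, E) p, ∀ᶠ x in 𝓝 p,
      coframe p x (cov (extend E c) x (extend E b x))
        = christoffel cov p (extChartAt 𝓘(ℝ, E) p x) (coframe p p c) (coframe p p b) := by
    intro b
    filter_upwards [source_mem_nhds hp] with x hx
    rw [extend_eq_frame hx b, coframe_cov_extend cov hx]
  have hΓ := (contDiffAt_christoffel hcov hp).differentiableAt (by simp)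
  have hΓb : ∀ b : E, DifferentiableAt ℝ (fun y => christoffel cov p y (coframe p p c) b)
      (extChartAt 𝓘(ℝ, E) p p) := fun b =>
    (hΓ.clm_apply (differentiableAt_const _)).clm_apply (differentiableAt_const _)
  have hd : ∀ b : TangentSpace 𝓘(ℝ, E) p,
      DiffFieldAt (fun x => cov (extend E c) x (extend E b x)) p := by
    intro b
    rw [diffFieldAt_iff hp]
    refine MDifferentiableAt.congr_of_eventuallyEq (MDifferentiableAt.comp p
      (hΓb (coframe p p b)).mdifferentiableAt
      ((contMDiffAt_chart hp).mdifferentiableAt (by simp))) (hev b)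
  have hcomp : ∀ b : TangentSpace 𝓘(ℝ, E) p,
      components p (fun x => cov (extend E c) x (extend E b x))
        =ᶠ[𝓝 (extChartAt 𝓘(ℝ, E) p p)]
        fun y => christoffel cov p y (coframe p p c) (coframe p p b) := by
    intro b
    filter_upwards [(tendsto_symm hp).eventually (hev b),
      (isOpen_extChartAt_target p).mem_nhds ((extChartAt 𝓘(ℝ, E) p).map_source hp)] with y hy hy'
    rw [components, hy, (extChartAt 𝓘(ℝ, E) p).right_inv hy']
  have hterm : ∀ a b : TangentSpace 𝓘(ℝ, E) p,
      coframe p p (cov (fun x => cov (extend E c) x (extend E b x)) p a)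
        = fderiv ℝ (christoffel cov p) (extChartAt 𝓘(ℝ, E) p p) (coframe p p a) (coframe p p c)
            (coframe p p b)
          + christoffel cov p (extChartAt 𝓘(ℝ, E) p p)
            (christoffel cov p (extChartAt 𝓘(ℝ, E) p p) (coframe p p c) (coframe p p b))
            (coframe p p a) := by
    intro a b
    have h := coframe_cov cov hp (hd b) (coframe p p a)
    rw [frame_coframe hp] at h
    rw [h, covAlong_id, (hcomp b).fderiv_eq, (hcomp b).self_of_nhds,
      fderiv_clm_apply_const₂ hΓ]
  rw [curvatureTensor, mlieBracket_extend a b hp, map_zero, sub_zero, map_sub, hterm, hterm,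
    christoffelCurvature]
  abel

/-- A one-form in the preferred chart at `p`. -/
def formComponents (p : M) (θ : ∀ q : M, TangentSpace 𝓘(ℝ, E) q →L[ℝ] ℝ) (y : E) : E →L[ℝ] ℝ :=
  θ ((extChartAt 𝓘(ℝ, E) p).symm y) ∘L frame p ((extChartAt 𝓘(ℝ, E) p).symm y)

/-- A field of endomorphisms of the tangent spaces in the preferred chart at `p`. -/
def endComponents (p : M) (J : ∀ q : M, TangentSpace 𝓘(ℝ, E) q →L[ℝ] TangentSpace 𝓘(ℝ, E) q)
    (y : E) : E →L[ℝ] E :=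
  coframe p ((extChartAt 𝓘(ℝ, E) p).symm y) ∘L J ((extChartAt 𝓘(ℝ, E) p).symm y)
    ∘L frame p ((extChartAt 𝓘(ℝ, E) p).symm y)

/-- A bilinear form on the tangent spaces in the preferred chart at `p`. -/
def bilinComponents (p : M)
    (g : ∀ q : M, TangentSpace 𝓘(ℝ, E) q →L[ℝ] TangentSpace 𝓘(ℝ, E) q →L[ℝ] ℝ)
    (y : E) : E →L[ℝ] E →L[ℝ] ℝ :=
  (frame p ((extChartAt 𝓘(ℝ, E) p).symm y)).precomp ℝ ∘L g ((extChartAt 𝓘(ℝ, E) p).symm y)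
    ∘L frame p ((extChartAt 𝓘(ℝ, E) p).symm y)

omit [FiniteDimensional ℝ E] in
lemma smoothFieldAt_frame (hq : q ∈ (extChartAt 𝓘(ℝ, E) p).source) (a : E) :
    SmoothFieldAt (fun x => frame (E := E) p x a) q :=
  smoothFieldAt_fieldOf (v := fun _ => a) hq contDiffAt_const

lemma contDiffAt_formComponents {θ : ∀ q : M, TangentSpace 𝓘(ℝ, E) q →L[ℝ] ℝ}
    (hθ : ContMDiff 𝓘(ℝ, E) (𝓘(ℝ, E).prod 𝓘(ℝ, E →L[ℝ] ℝ)) ∞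
      (fun p => TotalSpace.mk' (E →L[ℝ] ℝ) p (θ p)))
    (hq : q ∈ (extChartAt 𝓘(ℝ, E) p).source) :
    ContDiffAt ℝ ∞ (formComponents p θ) (extChartAt 𝓘(ℝ, E) p q) := by
  refine contDiffAt_of_clm_apply fun a => ?_
  have h := ContMDiffAt.clm_bundle_apply (b := fun x => x) (hθ q) (smoothFieldAt_frame hq a)
  rw [contMDiffAt_totalSpace] at h
  exact contDiffAt_comp_symm (f := fun x => θ x (frame (E := E) p x a)) hq h.2

lemma contDiffAt_endComponents
    {J : ∀ q : M, TangentSpace 𝓘(ℝ, E) q →L[ℝ] TangentSpace 𝓘(ℝ, E) q}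
    (hJ : ContMDiff 𝓘(ℝ, E) (𝓘(ℝ, E).prod 𝓘(ℝ, E →L[ℝ] E)) ∞
      (fun p => TotalSpace.mk' (E →L[ℝ] E) p (J p)))
    (hq : q ∈ (extChartAt 𝓘(ℝ, E) p).source) :
    ContDiffAt ℝ ∞ (endComponents p J) (extChartAt 𝓘(ℝ, E) p q) := by
  refine contDiffAt_of_clm_apply fun a => ?_
  have h : SmoothFieldAt (fun x => J x (frame (E := E) p x a)) q :=
    ContMDiffAt.clm_bundle_apply (b := fun x => x) (hJ q) (smoothFieldAt_frame hq a)
  exact h.components hq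

lemma contDiffAt_bilinComponents
    {g : ∀ q : M, TangentSpace 𝓘(ℝ, E) q →L[ℝ] TangentSpace 𝓘(ℝ, E) q →L[ℝ] ℝ}
    (hg : ContMDiff 𝓘(ℝ, E) (𝓘(ℝ, E).prod 𝓘(ℝ, E →L[ℝ] E →L[ℝ] ℝ)) ∞
      (fun p => TotalSpace.mk' (E →L[ℝ] E →L[ℝ] ℝ) p (g p)))
    (hq : q ∈ (extChartAt 𝓘(ℝ, E) p).source) :
    ContDiffAt ℝ ∞ (bilinComponents p g) (extChartAt 𝓘(ℝ, E) p q) := by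
  refine contDiffAt_of_clm_apply fun a => contDiffAt_of_clm_apply fun b => ?_
  have h := ContMDiffAt.clm_bundle_apply₂ (b := fun x => x) (hg q) (smoothFieldAt_frame hq a)
    (smoothFieldAt_frame hq b)
  rw [contMDiffAt_totalSpace] at h
  exact contDiffAt_comp_symm
    (f := fun x => g x (frame (E := E) p x a) (frame (E := E) p x b)) hq h.2

end Tensors

section Maps

variable {E : Type*} [NormedAddCommGroup E] [NormedSpace ℝ E]
  {M : Type*} [TopologicalSpace M] [ChartedSpace E M] [IsManifold 𝓘(ℝ, E) ∞ M]
  {E' : Type*} [NormedAddCommGroup E'] [NormedSpace ℝ E']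
  {X : Type*} [TopologicalSpace X] [ChartedSpace E' X] [IsManifold 𝓘(ℝ, E') ∞ X]

/-- The map `F` in the preferred charts at `p` and `x`. -/
def mapComponents (p : M) (x : X) (F : M → X) (y : E) : E' :=
  extChartAt 𝓘(ℝ, E') x (F ((extChartAt 𝓘(ℝ, E) p).symm y))

variable {p q : M} {x : X} {F : M → X}

lemma contDiffAt_mapComponents (hq : q ∈ (extChartAt 𝓘(ℝ, E) p).source)
    (hx : F q ∈ (extChartAt 𝓘(ℝ, E') x).source)
    (hF : ContMDiffAt 𝓘(ℝ, E) 𝓘(ℝ, E') ∞ F q) :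
    ContDiffAt ℝ ∞ (mapComponents (E := E) (E' := E') p x F) (extChartAt 𝓘(ℝ, E) p q) :=
  contDiffAt_comp_symm hq ((contMDiffAt_chart hx).comp q hF)

/-- The differential of `F` in the preferred charts at `p` and `x`. -/
lemma coframe_mfderiv (hq : q ∈ (extChartAt 𝓘(ℝ, E) p).source)
    (hx : F q ∈ (extChartAt 𝓘(ℝ, E') x).source)
    (hF : ContMDiffAt 𝓘(ℝ, E) 𝓘(ℝ, E') ∞ F q) (a : E) :
    coframe x (F q) (mfderiv 𝓘(ℝ, E) 𝓘(ℝ, E') F q (frame p q a))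
      = fderiv ℝ (mapComponents (E := E) (E' := E') p x F) (extChartAt 𝓘(ℝ, E) p q) a := by
  have hd : MDifferentiableAt 𝓘(ℝ, E) 𝓘(ℝ, E') F q := hF.mdifferentiableAt (by simp)
  have hφ : MDifferentiableAt 𝓘(ℝ, E') 𝓘(ℝ, E') (extChartAt 𝓘(ℝ, E') x) (F q) :=
    (contMDiffAt_chart hx).mdifferentiableAt (by simp)
  have h := mvfderiv_frame (f := fun z => extChartAt 𝓘(ℝ, E') x (F z)) hq
    (MDifferentiableAt.comp q hφ hd) a
  rw [coframe_eq_mfderiv hx]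
  refine Eq.trans ?_ h
  exact (mfderiv_comp_apply q hφ hd (frame p q a)).symm

lemma mfderiv_frame (hq : q ∈ (extChartAt 𝓘(ℝ, E) p).source)
    (hx : F q ∈ (extChartAt 𝓘(ℝ, E') x).source)
    (hF : ContMDiffAt 𝓘(ℝ, E) 𝓘(ℝ, E') ∞ F q) (a : E) :
    mfderiv 𝓘(ℝ, E) 𝓘(ℝ, E') F q (frame p q a)
      = frame x (F q)
        (fderiv ℝ (mapComponents (E := E) (E' := E') p x F) (extChartAt 𝓘(ℝ, E) p q) a) := by
  rw [← coframe_mfderiv hq hx hF, frame_coframe hx]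

omit [IsManifold 𝓘(ℝ, E) ∞ M] [IsManifold 𝓘(ℝ, E') ∞ X] in
/-- An immersion has smooth local left inverses. -/
lemma exists_leftInverse (hF : Manifold.IsImmersionAt 𝓘(ℝ, E) 𝓘(ℝ, E') ∞ F p) :
    ∃ r : X → M, ContMDiffAt 𝓘(ℝ, E') 𝓘(ℝ, E) ∞ r (F p) ∧ ∀ᶠ q in 𝓝 p, r (F q) = q := by
  set c := hF.codChart.extend 𝓘(ℝ, E')
  set d := hF.domChart.extend 𝓘(ℝ, E)
  let r : X → M := fun z => d.symm (hF.equiv.symm (c z)).1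
  have hr : ∀ q ∈ hF.domChart.source, r (F q) = q ∧ (hF.equiv.symm (c (F q))).1 = d q := by
    intro q hq
    have hq' : q ∈ d.source := by simpa [d] using hq
    have h := hF.writtenInCharts (d.map_source hq')
    simp only [Function.comp_apply] at h
    rw [show (hF.domChart.extend 𝓘(ℝ, E)).symm (d q) = q from d.left_inv hq'] at h
    have h' : (hF.equiv.symm (c (F q))).1 = d q := by
      rw [show c (F q) = hF.equiv (d q, 0) from h]; simp
    exact ⟨by simp only [r]; rw [h']; exact d.left_inv hq', h'⟩
  refine ⟨r, ?_, ?_⟩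
  · have h1 : ContMDiffAt 𝓘(ℝ, E') 𝓘(ℝ, E') ∞ c (F p) :=
      OpenPartialHomeomorph.contMDiffAt_extend hF.codChart_mem_maximalAtlas hF.mem_codChart_source
    have h2 : ContMDiffAt 𝓘(ℝ, E') 𝓘(ℝ, E) ∞ (fun z => (hF.equiv.symm (c z)).1) (F p) := by
      have : ContDiff ℝ ∞ (fun w => (hF.equiv.symm w).1) :=
        contDiff_fst.comp hF.equiv.symm.contDiff
      exact this.contMDiff.contMDiffAt.comp (F p) h1
    have h3 : ContMDiffAt 𝓘(ℝ, E) 𝓘(ℝ, E) ∞ d.symm (d p) := by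
      have := contMDiffOn_extend_symm hF.domChart_mem_maximalAtlas (I := 𝓘(ℝ, E))
      refine this.contMDiffAt ?_
      refine IsOpen.mem_nhds (by simpa using hF.domChart.open_target) ⟨hF.domChart p,
        hF.domChart.map_source hF.mem_domChart_source, rfl⟩
    exact h3.comp_of_eq h2 (hr p hF.mem_domChart_source).2
  · filter_upwards [hF.domChart.open_source.mem_nhds hF.mem_domChart_source] with q hq
    exact (hr q hq).1

end Maps

/-! ### The Chern connection of a Kähler metric -/

section KahlerAlgebra

variable {E : Type*} [NormedAddCommGroup E] [NormedSpace ℂ E]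

/-- The pointwise algebra behind the equality of the Chern and the Levi-Civita connections of a
Kähler metric. The Christoffel symbols `Γ v u = ∇_u v` are taken in a holomorphic chart. Type
considerations make them complex linear in the direction `u` as well, so that the torsion is complex
bilinear; then closedness of the fundamental form makes it vanish. -/
lemma christoffel_symm_of_closed {Γ : E →L[ℝ] E →L[ℝ] E} {g : E →L[ℝ] E →L[ℝ] ℝ}
    (hgs : ∀ u v, g u v = g v u) (hgp : ∀ v, v ≠ 0 → 0 < g v v)
    (hgI : ∀ u v, g (Complex.I • u) (Complex.I • v) = g u v)
    (hΓI : ∀ u v, Γ (Complex.I • u) v = Complex.I • Γ u v)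
    (htor : ∀ u v, Γ v (Complex.I • u) - Γ (Complex.I • u) v
      = Γ (Complex.I • v) u - Γ u (Complex.I • v))
    (hclosed : ∀ u v w,
      (g (Γ (Complex.I • v) u) w + g (Complex.I • v) (Γ w u))
      + (g (Γ (Complex.I • w) v) u + g (Complex.I • w) (Γ u v))
      + (g (Γ (Complex.I • u) w) v + g (Complex.I • u) (Γ v w)) = 0) (u v : E) :
    Γ u v = Γ v u := by
  have hII : ∀ z : E, Complex.I • Complex.I • z = -z := fun z => by
    rw [smul_smul, Complex.I_mul_I, neg_one_smul]
  -- `N u v` is the failure of complex linearity in the direction `u`. It is skew, by the condition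
  -- on the torsion, antilinear in `u`, and linear in `v`, hence zero.
  let N : E → E → E := fun u v => Γ v (Complex.I • u) - Complex.I • Γ v u
  have hN1 : ∀ u v, N u v = -N v u := by
    intro u v
    have := htor u v
    rw [hΓI, hΓI] at this
    simp only [N]
    rw [eq_add_of_sub_eq this]
    abel
  have hN2 : ∀ u v, N u (Complex.I • v) = Complex.I • N u v := by
    intro u v
    simp only [N, hΓI, smul_sub]
  have hN3 : ∀ u v, N (Complex.I • u) v = -(Complex.I • N u v) := by
    intro u v
    simp only [N, hII, map_neg, smul_sub]
    abel
  have hN : ∀ u v, N u v = 0 := by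
    intro u v
    have h1 : Complex.I • N u v = -(Complex.I • N u v) := by
      rw [← hN3, hN1 (Complex.I • u), hN2, hN1 u, smul_neg]
    have h2 : (2 : ℂ) • (Complex.I • N u v) = 0 := by
      rw [two_smul]
      nth_rewrite 1 [h1]
      exact neg_add_cancel _
    simpa using h2
  have hΓ2 : ∀ u v, Γ v (Complex.I • u) = Complex.I • Γ v u := fun u v => sub_eq_zero.1 (hN u v)
  have hgI2 : ∀ u v, g (Complex.I • u) v = -g (Complex.I • v) u := by
    intro u v
    rw [← hgI (Complex.I • u) v, hII, map_neg, hgs (Complex.I • v)]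
    simp
  let C : E → E → E → ℝ := fun u v w => g (Γ v u) w - g (Γ u v) w
  -- Closedness at `(i u, v, w)` is the vanishing of the cyclic sum with one sign changed.
  have hC : ∀ u v w, C u v w - C v w u + C w u v = 0 := by
    intro u v w
    have h := hclosed (Complex.I • u) v w
    simp only [hΓI, hΓ2, hII, hgI, map_neg, neg_apply] at h
    simp only [C]
    linarith [hgs v (Γ w u), hgs u (Γ w v), hgs w (Γ u v), hgs u (Γ v w)]
  have hC0 : ∀ u v w, C u v w = 0 := by
    intro u v w
    linarith [hC u v w, hC v w u]
  by_contra hne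
  have := hgp (Γ u v - Γ v u) (sub_ne_zero.2 hne)
  have h0 := hC0 u v (Γ u v - Γ v u)
  simp only [C] at h0
  rw [map_sub g, sub_apply] at this
  linarith

end KahlerAlgebra

section Kahler

variable {E : Type*} [NormedAddCommGroup E] [NormedSpace ℂ E] {X : Type*} [TopologicalSpace X]
  [ChartedSpace E X] [IsManifold 𝓘(ℂ, E) ω X] {x z : X}

/-- Multiplication by `i` commutes with the coordinate changes, which are holomorphic. -/
lemma frame_I_smul (hz : z ∈ (extChartAt 𝓘(ℝ, E) x).source) (a : E) :
    frame (E := E) x z (Complex.I • a) = complexStructure z (frame (E := E) x z a) := by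
  have hz' : z ∈ (chartAt E x).source := by simpa using hz
  have h := TangentBundle.symmL_trivializationAt_eq_core (𝕜 := ℝ) (I := 𝓘(ℝ, E)) (b₀ := x) hz'
  have hd : DifferentiableAt ℂ ((chartAt E z) ∘ (chartAt E x).symm) (chartAt E x z) := by
    have h1 := contDiffWithinAt_ext_coord_change (I := 𝓘(ℂ, E)) (n := ω) z x
      (y := chartAt E x z) (by
        simp [(chartAt E x).map_source hz', (chartAt E x).left_inv hz'])
    have h2 := h1.differentiableWithinAt (by simp)
    rw [ModelWithCorners.range_eq_univ, differentiableWithinAt_univ] at h2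
    simpa using h2
  have hc : frame (E := E) x z = ((fderiv ℂ ((chartAt E z) ∘ (chartAt E x).symm)
      (chartAt E x z)).restrictScalars ℝ : E →L[ℝ] E) := by
    unfold frame
    rw [h, ← hd.fderiv_restrictScalars ℝ]
    rw [tangentBundleCore_coordChange_achart, ModelWithCorners.range_eq_univ, fderivWithin_univ]
    simp
    rfl
  rw [hc]
  exact map_smul (fderiv ℂ ((chartAt E z) ∘ (chartAt E x).symm) (chartAt E x z)) Complex.I a

lemma coframe_complexStructure (hz : z ∈ (extChartAt 𝓘(ℝ, E) x).source)
    (v : TangentSpace 𝓘(ℝ, E) z) :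
    coframe (E := E) x z (complexStructure z v) = Complex.I • coframe (E := E) x z v := by
  have h := frame_I_smul hz (coframe (E := E) x z v)
  rw [frame_coframe hz] at h
  rw [← h, coframe_frame hz]

variable [FiniteDimensional ℂ E] {g : RealMetric E X} {cov : AffineConnection E X}

lemma christoffel_I_smul (hcov : IsChernConnection g cov)
    (hz : z ∈ (extChartAt 𝓘(ℝ, E) x).source) (u a : E) :
    christoffel cov x (extChartAt 𝓘(ℝ, E) x z) (Complex.I • u) a
      = Complex.I • christoffel cov x (extChartAt 𝓘(ℝ, E) x z) u a := by
  have hc : ∀ u, coframe x z (cov (fun y => frame (E := E) x y u) z (frame x z a))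
      = christoffel cov x (extChartAt 𝓘(ℝ, E) x z) u a := by
    intro u
    refine (cov_fieldOf cov hz (v := fun _ => u) (by fun_prop) a).trans ?_
    simp [covAlong_id]
  have hd : ∀ u : E, DiffFieldAt (fun y => frame (E := E) x y u) z := fun u =>
    diffFieldAt_fieldOf (v := fun _ => u) hz (by fun_prop)
  have hev : (fun y => frame (E := E) x y (Complex.I • u)) =ᶠ[𝓝 z]
      fun y => complexStructure y (frame (E := E) x y u) := by
    filter_upwards [source_mem_nhds hz] with y hy using frame_I_smul hy u
  have hd' : DiffFieldAt (fun y => complexStructure y (frame (E := E) x y u)) z := by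
    refine (hd (Complex.I • u)).congr_of_eventuallyEq ?_
    filter_upwards [hev] with y hy
    exact congrArg _ hy.symm
  rw [← hc, ← hc, cov.isCovariantDerivativeOnUniv.congr_of_eventuallyEq (hd _) hd'
    Filter.univ_mem hev, hcov.parallel_J z _ _ (hd u), coframe_complexStructure hz]

omit [FiniteDimensional ℂ E] in
lemma bilinComponents_inner (hz : z ∈ (extChartAt 𝓘(ℝ, E) x).source) (u v : E) :
    bilinComponents x g.inner (extChartAt 𝓘(ℝ, E) x z) u v
      = g.val z (frame (E := E) x z u) (frame (E := E) x z v) := by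
  exact congrArg (fun q => g.val q (frame (E := E) x q u) (frame (E := E) x q v))
    ((extChartAt 𝓘(ℝ, E) x).left_inv hz)

lemma mvfderiv_metric_frame (hz : z ∈ (extChartAt 𝓘(ℝ, E) x).source) (a u v : E) :
    mvfderiv 𝓘(ℝ, E) (fun y => g.val y (frame (E := E) x y u) (frame (E := E) x y v)) z
        (frame (E := E) x z a)
      = fderiv ℝ (bilinComponents x g.inner) (extChartAt 𝓘(ℝ, E) x z) a u v := by
  have hsm := contDiffAt_bilinComponents g.contMDiff hz
  have hd := hsm.differentiableAt (by simp)
  rw [mvfderiv_frame_of_eventuallyEq (f' := fun y => bilinComponents x g.inner y u v) hz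
    (by fun_prop), fderiv_clm_apply_const₂ hd]
  filter_upwards [source_mem_nhds hz] with y hy using (bilinComponents_inner hy u v).symm

lemma fderiv_bilinComponents_inner (hcov : IsChernConnection g cov)
    (hz : z ∈ (extChartAt 𝓘(ℝ, E) x).source) (a u v : E) :
    fderiv ℝ (bilinComponents x g.inner) (extChartAt 𝓘(ℝ, E) x z) a u v
      = bilinComponents x g.inner (extChartAt 𝓘(ℝ, E) x z)
          (christoffel cov x (extChartAt 𝓘(ℝ, E) x z) u a) v
        + bilinComponents x g.inner (extChartAt 𝓘(ℝ, E) x z) u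
          (christoffel cov x (extChartAt 𝓘(ℝ, E) x z) v a) := by
  have hc : ∀ u, cov (fun y => frame (E := E) x y u) z (frame x z a)
      = frame x z (christoffel cov x (extChartAt 𝓘(ℝ, E) x z) u a) := by
    intro u
    rw [← frame_coframe hz (cov (fun y => frame (E := E) x y u) z (frame x z a))]
    refine congrArg _ ((cov_fieldOf cov hz (v := fun _ => u) (by fun_prop) a).trans ?_)
    simp [covAlong_id]
  have hd : ∀ u : E, DiffFieldAt (fun y => frame (E := E) x y u) z := fun u =>
    diffFieldAt_fieldOf (v := fun _ => u) hz (by fun_prop)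
  rw [← mvfderiv_metric_frame hz, hcov.parallel_g z _ _ _ (hd u) (hd v), hc, hc,
    bilinComponents_inner hz, bilinComponents_inner hz]

/-- The Chern connection of a Kähler metric has no torsion. -/
lemma torsionTensor_eq_zero (hg : IsKahler g) (hcov : IsChernConnection g cov)
    (u v : TangentSpace 𝓘(ℝ, E) x) : torsionTensor cov x u v = 0 := by
  have : CompleteSpace E := FiniteDimensional.complete ℝ E
  have hx := mem_extChartAt_source (I := 𝓘(ℝ, E)) x
  set y := extChartAt 𝓘(ℝ, E) x x with hy
  have hframe : ∀ v : TangentSpace 𝓘(ℝ, E) x, frame x x (coframe (E := E) x x v) = v :=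
    frame_coframe hx
  have hτ := coframe_torsionTensor cov hx
  have key := christoffel_symm_of_closed (Γ := christoffel cov x y)
    (g := bilinComponents x g.inner y) ?_ ?_ ?_ (christoffel_I_smul hcov hx) ?_ ?_
  · rw [← hframe (torsionTensor cov x u v), ← hframe u, ← hframe v, hτ, key, sub_self, map_zero]
  · intro u v
    rw [bilinComponents_inner hx, bilinComponents_inner hx]
    exact g.symm x _ _
  · intro v hv
    rw [bilinComponents_inner hx]
    refine g.pos x _ fun h => hv ?_
    rw [← coframe_frame hx v]
    exact (congrArg _ h).trans (map_zero _)
  · intro u v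
    rw [bilinComponents_inner hx, bilinComponents_inner hx, frame_I_smul hx, frame_I_smul hx,
      hg.hermitian]
  · intro u v
    rw [← hτ, ← hτ, frame_I_smul hx, frame_I_smul hx, hcov.torsion_11]
  · intro u v w
    have hev : ∀ v w : E, (fun q => fundamentalForm g q (extend E (frame (E := E) x x v) q)
        (extend E (frame (E := E) x x w) q)) =ᶠ[𝓝 x]
        fun q => g.val q (frame (E := E) x q (Complex.I • v)) (frame (E := E) x q w) := by
      intro v w
      filter_upwards [source_mem_nhds hx] with q hq
      rw [extend_eq_frame hq, extend_eq_frame hq, coframe_frame hx, coframe_frame hx,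
        fundamentalForm, frame_I_smul hq]
    have hm : ∀ u v w : E, mvfderiv 𝓘(ℝ, E) (fun q => fundamentalForm g q
        (extend E (frame (E := E) x x v) q) (extend E (frame (E := E) x x w) q)) x
          (frame (E := E) x x u)
        = fderiv ℝ (bilinComponents x g.inner) y u (Complex.I • v) w := by
      intro u v w
      rw [← mvfderiv_metric_frame hx]
      unfold mvfderiv
      rw [(hev v w).mfderiv_eq]
      rfl
    have h := hg.closed x (frame (E := E) x x u) (frame (E := E) x x v) (frame (E := E) x x w)
    have h0 : ∀ w, fundamentalForm g x 0 w = 0 := fun w => by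
      simp [fundamentalForm, RealMetric.val]
    rw [extDerivTwo, mlieBracket_extend _ _ hx, mlieBracket_extend _ _ hx,
      mlieBracket_extend _ _ hx, h0, h0, h0, sub_zero, sub_zero, sub_zero, hm, hm, hm] at h
    simp only [hy, fderiv_bilinComponents_inner hcov hx] at h
    exact h

/-- The Christoffel symbols of the Chern connection of a Kähler metric are symmetric. -/
lemma christoffel_symm (hg : IsKahler g) (hcov : IsChernConnection g cov)
    (hz : z ∈ (extChartAt 𝓘(ℝ, E) x).source) (u v : E) :
    christoffel cov x (extChartAt 𝓘(ℝ, E) x z) u v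
      = christoffel cov x (extChartAt 𝓘(ℝ, E) x z) v u := by
  rw [← sub_eq_zero, ← coframe_torsionTensor cov hz, torsionTensor_eq_zero hg hcov]
  exact map_zero _

end Kahler

/-! ### Pseudohermitian submanifolds in charts -/

section Charts

variable {E : Type*} [NormedAddCommGroup E] [NormedSpace ℝ E]
  {M : Type*} [TopologicalSpace M] [ChartedSpace E M] [IsManifold 𝓘(ℝ, E) ∞ M] {p q : M}

lemma covAlong_congr {E' : Type*} [NormedAddCommGroup E'] [NormedSpace ℝ E'] {F : E → E'}
    {Γ' : E' → E' →L[ℝ] E' →L[ℝ] E'} {w₁ w₂ : E → E'} {y : E} (h : w₁ =ᶠ[𝓝 y] w₂) (a : E) :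
    covAlong F Γ' w₁ y a = covAlong F Γ' w₂ y a := by
  rw [covAlong, covAlong, h.fderiv_eq, h.self_of_nhds]

lemma formComponents_apply (θ : ∀ q : M, TangentSpace 𝓘(ℝ, E) q →L[ℝ] ℝ)
    (hq : q ∈ (extChartAt 𝓘(ℝ, E) p).source) (v : E) :
    formComponents p θ (extChartAt 𝓘(ℝ, E) p q) v = θ q (frame (E := E) p q v) :=
  congrArg (fun z => θ z (frame (E := E) p z v)) ((extChartAt 𝓘(ℝ, E) p).left_inv hq)

lemma components_chart (V : ∀ q : M, TangentSpace 𝓘(ℝ, E) q)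
    (hq : q ∈ (extChartAt 𝓘(ℝ, E) p).source) :
    components p V (extChartAt 𝓘(ℝ, E) p q) = coframe p q (V q) :=
  congrArg (fun z => coframe p z (V z)) ((extChartAt 𝓘(ℝ, E) p).left_inv hq)

lemma frame_components (V : ∀ q : M, TangentSpace 𝓘(ℝ, E) q)
    (hq : q ∈ (extChartAt 𝓘(ℝ, E) p).source) :
    frame p q (components p V (extChartAt 𝓘(ℝ, E) p q)) = V q := by
  rw [components_chart V hq, frame_coframe hq]

lemma endComponents_apply (J : ∀ q : M, TangentSpace 𝓘(ℝ, E) q →L[ℝ] TangentSpace 𝓘(ℝ, E) q)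
    (hq : q ∈ (extChartAt 𝓘(ℝ, E) p).source) (v : E) :
    endComponents p J (extChartAt 𝓘(ℝ, E) p q) v = coframe p q (J q (frame (E := E) p q v)) :=
  congrArg (fun z => coframe p z (J z (frame (E := E) p z v)))
    ((extChartAt 𝓘(ℝ, E) p).left_inv hq)

lemma frame_endComponents (J : ∀ q : M, TangentSpace 𝓘(ℝ, E) q →L[ℝ] TangentSpace 𝓘(ℝ, E) q)
    (hq : q ∈ (extChartAt 𝓘(ℝ, E) p).source) (v : E) :
    frame p q (endComponents p J (extChartAt 𝓘(ℝ, E) p q) v) = J q (frame (E := E) p q v) := by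
  rw [endComponents_apply J hq, frame_coframe hq]

end Charts

section Local

variable {E : Type*} [NormedAddCommGroup E] [NormedSpace ℝ E]
  {M : Type*} [TopologicalSpace M] [ChartedSpace E M] [IsManifold 𝓘(ℝ, E) ∞ M]
  {E' : Type*} [NormedAddCommGroup E'] [NormedSpace ℂ E']
  {X : Type*} [TopologicalSpace X] [ChartedSpace E' X] [IsManifold 𝓘(ℂ, E') ω X]
  {S : PseudohermitianStructure E M} {g : RealMetric E' X} {ι : M → X} {p q : M}

omit [IsManifold 𝓘(ℝ, E) ∞ M] [IsManifold 𝓘(ℂ, E') ω X] in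
lemma mapComponents_chart {x : X} (hq : q ∈ (extChartAt 𝓘(ℝ, E) p).source) :
    mapComponents (E := E) (E' := E') p x ι (extChartAt 𝓘(ℝ, E) p q)
      = extChartAt 𝓘(ℝ, E') x (ι q) :=
  congrArg (fun z => extChartAt 𝓘(ℝ, E') x (ι z)) ((extChartAt 𝓘(ℝ, E) p).left_inv hq)

lemma IsPseudohermitianSubmanifold.contMDiffAt (hι : IsPseudohermitianSubmanifold S g ι) (q : M) :
    ContMDiffAt 𝓘(ℝ, E) 𝓘(ℝ, E') ∞ ι q :=
  hι.immersion.contMDiff q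

variable [FiniteDimensional ℝ E] [FiniteDimensional ℂ E']

omit [FiniteDimensional ℝ E] [FiniteDimensional ℂ E'] in
lemma IsPseudohermitianSubmanifold.extDerivOne_frame (hι : IsPseudohermitianSubmanifold S g ι)
    (hq : q ∈ (extChartAt 𝓘(ℝ, E) p).source) (hx : ι q ∈ (extChartAt 𝓘(ℝ, E') (ι p)).source)
    (a b : E) :
    extDerivOne S.θ q (frame (E := E) p q a) (frame (E := E) p q b)
      = bilinComponents (ι p) g.inner (extChartAt 𝓘(ℝ, E') (ι p) (ι q))
        (Complex.I • fderiv ℝ (mapComponents (E := E) (E' := E') p (ι p) ι)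
          (extChartAt 𝓘(ℝ, E) p q) a)
        (fderiv ℝ (mapComponents (E := E) (E' := E') p (ι p) ι) (extChartAt 𝓘(ℝ, E) p q) b) := by
  rw [hι.semiIsometric, bilinComponents_inner hx, push, mfderiv_frame hq hx (hι.contMDiffAt q),
    mfderiv_frame hq hx (hι.contMDiffAt q), fundamentalForm, frame_I_smul hx]

/-- A pseudohermitian submanifold in the preferred charts at `p` and `ι p`. -/
lemma isLocalPseudohermitianSubmanifold (hg : IsKahler g)
    (hι : IsPseudohermitianSubmanifold S g ι) {cov' : AffineConnection E' X}
    (hcov' : IsChernConnection g cov') {cov : AffineConnection E M} (hcov : S.IsTanakaWebster cov)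
    (p : M) :
    IsLocalPseudohermitianSubmanifold
      ((extChartAt 𝓘(ℝ, E) p).target ∩
        (ι ∘ (extChartAt 𝓘(ℝ, E) p).symm) ⁻¹' (extChartAt 𝓘(ℝ, E') (ι p)).source)
      (mapComponents (E := E) (E' := E') p (ι p) ι) (christoffel cov p) (christoffel cov' (ι p))
      (formComponents p S.θ) (endComponents p S.J) (components p S.T)
      (bilinComponents (ι p) g.inner) := by
  set U := (extChartAt 𝓘(ℝ, E) p).target ∩
        (ι ∘ (extChartAt 𝓘(ℝ, E) p).symm) ⁻¹' (extChartAt 𝓘(ℝ, E') (ι p)).source with hU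
  set F := mapComponents (E := E) (E' := E') p (ι p) ι with hF
  set φ := extChartAt 𝓘(ℝ, E) p with hφ
  have hforall : ∀ P : E → Prop, (∀ q ∈ φ.source, ι q ∈ (extChartAt 𝓘(ℝ, E') (ι p)).source →
      P (φ q)) → ∀ y ∈ U, P y := by
    intro P h y hy
    have := h (φ.symm y) (φ.map_target hy.1) hy.2
    rwa [φ.right_inv hy.1] at this
  have hFq : ∀ q ∈ φ.source, F (φ q) = extChartAt 𝓘(ℝ, E') (ι p) (ι q) := fun q hq =>
    mapComponents_chart hq
  have hnear : ∀ q ∈ φ.source, ι q ∈ (extChartAt 𝓘(ℝ, E') (ι p)).source →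
      ∀ᶠ z in 𝓝 q, z ∈ φ.source ∧ ι z ∈ (extChartAt 𝓘(ℝ, E') (ι p)).source := fun q hq hx =>
    Filter.Eventually.and (source_mem_nhds hq)
      ((hι.contMDiffAt q).continuousAt.eventually (source_mem_nhds hx))
  have hcov_frame : ∀ q ∈ φ.source, ∀ (V : E → E) (a : E), DifferentiableAt ℝ V (φ q) →
      cov (fieldOf p V) q (frame (E := E) p q a)
        = frame p q (covAlong (fun x => x) (christoffel cov p) V (φ q) a) := by
    intro q hq V a hV
    rw [← cov_fieldOf cov hq hV, frame_coframe hq]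
  have hlevi : ∀ q ∈ φ.source, ι q ∈ (extChartAt 𝓘(ℝ, E') (ι p)).source → ∀ a b : E,
      S.leviMetric q (frame (E := E) p q a) (frame (E := E) p q b)
      = bilinComponents (ι p) g.inner (F (φ q)) (Complex.I • fderiv ℝ F (φ q) a)
        (fderiv ℝ F (φ q) (endComponents p S.J (φ q) b)) := by
    intro q hq hx a b
    rw [hFq q hq, ← hι.extDerivOne_frame hq hx, frame_endComponents S.J hq]
    rfl
  have hsF : ∀ q ∈ φ.source, ι q ∈ (extChartAt 𝓘(ℝ, E') (ι p)).source →
      ContDiffAt ℝ ∞ F (φ q) := fun q hq hx =>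
    contDiffAt_mapComponents hq hx (hι.contMDiffAt q)
  have hsg : ∀ q ∈ φ.source, ι q ∈ (extChartAt 𝓘(ℝ, E') (ι p)).source →
      ContDiffAt ℝ ∞ (bilinComponents (ι p) g.inner) (F (φ q)) := fun q hq hx => by
    rw [hFq q hq]
    exact contDiffAt_bilinComponents g.contMDiff hx
  have hsJ : ∀ q ∈ φ.source, ContDiffAt ℝ ∞ (endComponents p S.J) (φ q) := fun q hq =>
    contDiffAt_endComponents S.smooth_J hq
  refine
    { isOpen := ?_
      smooth_F := hforall _ hsF
      smooth_Γ := hforall _ fun q hq hx => contDiffAt_christoffel hcov.smooth hq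
      smooth_Γ' := hforall _ fun q hq hx => ?_
      smooth_θ := hforall _ fun q hq hx => contDiffAt_formComponents S.smooth_θ hq
      smooth_J := hforall _ fun q hq hx => hsJ q hq
      smooth_T := hforall _ fun q hq hx => SmoothFieldAt.components (S.smooth_T q) hq
      smooth_g := hforall _ hsg
      g_symm := hforall _ fun q hq hx u v => ?_
      g_I := hforall _ fun q hq hx u v => ?_
      g_parallel := hforall _ fun q hq hx a u v => ?_
      Γ'_symm := hforall _ fun q hq hx u v => ?_
      Γ'_I := hforall _ fun q hq hx u v => ?_
      θ_T := hforall _ fun q hq hx => ?_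
      θ_J := hforall _ fun q hq hx v hv => ?_
      J_J := hforall _ fun q hq hx v hv => ?_
      cr := hforall _ fun q hq hx v hv => ?_
      reeb := hforall _ fun q hq hx v => ?_
      θ_parallel := hforall _ fun q hq hx V a hV h => ?_
      J_parallel := hforall _ fun q hq hx V a hV => ?_
      T_parallel := hforall _ fun q hq hx a => ?_
      levi_parallel := hforall _ fun q hq hx V W a hV hW => ?_
      torsion := hforall _ fun q hq hx u v hu hv => ?_ }
  · exact (continuousOn_extChartAt_symm p).isOpen_inter_preimage (isOpen_extChartAt_target p)
      ((isOpen_extChartAt_source (ι p)).preimage hι.immersion.contMDiff.continuous)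
  · rw [hFq q hq]
    exact contDiffAt_christoffel hcov'.smooth hx
  · rw [hFq q hq, bilinComponents_inner hx, bilinComponents_inner hx]
    exact g.symm _ _ _
  · rw [hFq q hq, bilinComponents_inner hx, bilinComponents_inner hx, frame_I_smul hx,
      frame_I_smul hx, hg.hermitian]
  · rw [hFq q hq]
    exact fderiv_bilinComponents_inner hcov' hx a u v
  · rw [hFq q hq]
    exact christoffel_symm hg hcov' hx u v
  · rw [hFq q hq]
    exact christoffel_I_smul hcov' hx u v
  · rw [formComponents_apply _ hq, frame_components _ hq, S.θ_T]
  · rw [formComponents_apply _ hq] at hv ⊢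
    rw [frame_endComponents _ hq]
    exact S.θ_J q _ hv
  · rw [formComponents_apply _ hq] at hv
    rw [endComponents_apply _ hq, frame_endComponents _ hq, S.J_J q _ hv, map_neg,
      coframe_frame hq]
  · rw [formComponents_apply _ hq] at hv
    have h := hι.cr q _ hv
    rw [← frame_endComponents _ hq, push, mfderiv_frame hq hx (hι.contMDiffAt q),
      mfderiv_frame hq hx (hι.contMDiffAt q), ← frame_I_smul hx] at h
    rw [← coframe_frame hx (fderiv ℝ F (φ q) _), h, coframe_frame hx]
  · rw [hFq q hq, ← hι.extDerivOne_frame hq hx, frame_components _ hq, S.dθ_T]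
  · rw [formComponents_apply _ hq, ← hcov_frame q hq V a hV]
    refine hcov.parallel_H q _ _ (diffFieldAt_fieldOf hq hV) ?_
    filter_upwards [source_mem_nhds hq, (tendsto_chart hq).eventually h] with z hz h
    rwa [formComponents_apply _ hz] at h
  · have hJV : DifferentiableAt ℝ (fun x => endComponents p S.J x (V x)) (φ q) :=
      ((hsJ q hq).differentiableAt (by simp)).clm_apply hV
    have hev : (fieldOf p fun x => endComponents p S.J x (V x)) =ᶠ[𝓝 q]
        fun z => S.J z (fieldOf p V z) := by
      filter_upwards [source_mem_nhds hq] with z hz using frame_endComponents S.J hz _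
    have hd' : DiffFieldAt (fun z => S.J z (fieldOf p V z)) q := by
      refine (diffFieldAt_fieldOf hq hJV).congr_of_eventuallyEq ?_
      filter_upwards [hev] with y hy
      exact congrArg _ hy.symm
    rw [endComponents_apply _ hq, ← hcov_frame q hq V a hV,
      ← hcov.parallel_J q _ _ (diffFieldAt_fieldOf hq hV),
      ← cov.isCovariantDerivativeOnUniv.congr_of_eventuallyEq (diffFieldAt_fieldOf hq hJV) hd'
        Filter.univ_mem hev, cov_fieldOf cov hq hJV]
  · rw [← coframe_cov cov hq ((S.smooth_T q).mdifferentiableAt (by simp)), hcov.parallel_T]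
    exact map_zero _
  · have hd : DifferentiableAt ℝ (fun x => bilinComponents (ι p) g.inner (F x)
        (Complex.I • fderiv ℝ F x (V x)) (fderiv ℝ F x (endComponents p S.J x (W x)))) (φ q) := by
      have h1 := (hsF q hq hx).differentiableAt_fderiv
      have h2 := (hsJ q hq).differentiableAt (by simp)
      have h3 : DifferentiableAt ℝ (fun x => bilinComponents (ι p) g.inner (F x)) (φ q) :=
        DifferentiableAt.comp (G := E' →L[ℝ] E' →L[ℝ] ℝ) (g := bilinComponents (ι p) g.inner) _
          ((hsg q hq hx).differentiableAt (by simp)) ((hsF q hq hx).differentiableAt (by simp))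
      exact (h3.clm_apply ((h1.clm_apply hV).fun_const_smul Complex.I)).clm_apply
        (h1.clm_apply (h2.clm_apply hW))
    rw [← mvfderiv_frame_of_eventuallyEq (f := fun z => S.leviMetric z (fieldOf p V z)
      (fieldOf p W z)) hq hd, hcov.parallel_G q _ _ _ (diffFieldAt_fieldOf hq hV)
      (diffFieldAt_fieldOf hq hW), hcov_frame q hq V a hV, hcov_frame q hq W a hW]
    · exact congrArg₂ (· + ·) (hlevi q hq hx _ _) (hlevi q hq hx _ _)
    · filter_upwards [hnear q hq hx] with z hz using hlevi z hz.1 hz.2 _ _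
  · rw [formComponents_apply _ hq] at hu hv
    rw [← coframe_torsionTensor cov hq, hcov.torsion_H q _ _ hu hv, map_smul,
      components_chart _ hq, hFq q hq, ← hι.extDerivOne_frame hq hx]

end Local

/-! ### The second fundamental form in charts -/

lemma covAlong_comp {E E' : Type*} [NormedAddCommGroup E] [NormedSpace ℝ E]
    [NormedAddCommGroup E'] [NormedSpace ℝ E'] {F : E → E'} {Γ' : E' → E' →L[ℝ] E' →L[ℝ] E'}
    {w : E' → E'} {y : E} (hw : DifferentiableAt ℝ w (F y)) (hF : DifferentiableAt ℝ F y) (a : E) :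
    covAlong F Γ' (w ∘ F) y a = covAlong (fun x => x) Γ' w (F y) (fderiv ℝ F y a) := by
  rw [covAlong_id, covAlong, fderiv_comp y hw hF]
  rfl

section SecondFundamentalForm

variable {E : Type*} [NormedAddCommGroup E] [NormedSpace ℝ E]
  {M : Type*} [TopologicalSpace M] [ChartedSpace E M] [IsManifold 𝓘(ℝ, E) ∞ M]
  {E' : Type*} [NormedAddCommGroup E'] [NormedSpace ℂ E']
  {X : Type*} [TopologicalSpace X] [ChartedSpace E' X] [IsManifold 𝓘(ℂ, E') ω X]
  {ι : M → X} {p : M}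

lemma push_extend_eventuallyEq (hι : ContMDiff 𝓘(ℝ, E) 𝓘(ℝ, E') ∞ ι)
    (v : TangentSpace 𝓘(ℝ, E) p) :
    ∀ᶠ q in 𝓝 p, q ∈ (extChartAt 𝓘(ℝ, E) p).source ∧
      ι q ∈ (extChartAt 𝓘(ℝ, E') (ι p)).source ∧
      coframe (E := E') (ι p) (ι q) (push ι q (extend E v q))
        = fderiv ℝ (mapComponents (E := E) (E' := E') p (ι p) ι) (extChartAt 𝓘(ℝ, E) p q)
          (coframe p p v) := by
  filter_upwards [source_mem_nhds (mem_extChartAt_source (I := 𝓘(ℝ, E)) p),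
    hι.continuous.continuousAt.eventually
      (source_mem_nhds (mem_extChartAt_source (I := 𝓘(ℝ, E')) (ι p)))] with q hq hx
  refine ⟨hq, hx, ?_⟩
  rw [extend_eq_frame hq]
  exact coframe_mfderiv hq hx (hι q) _

/-- With a local left inverse `r` of the immersion, the field with components `w ∘ r` in a chart of
the ambient manifold extends the field along the immersion with components `w`. -/
lemma exists_isAmbientExtension (hι : Manifold.IsImmersion 𝓘(ℝ, E) 𝓘(ℝ, E') ∞ ι)
    (v : TangentSpace 𝓘(ℝ, E) p) :
    ∃ V' : ∀ x : X, TangentSpace 𝓘(ℝ, E') x, IsAmbientExtension ι p (extend E v) V' := by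
  obtain ⟨r, hr, hrι⟩ := exists_leftInverse (hι.isImmersionAt p)
  have hp := mem_extChartAt_source (I := 𝓘(ℝ, E)) p
  have hx := mem_extChartAt_source (I := 𝓘(ℝ, E')) (ι p)
  let w : M → E' := fun q => coframe (E := E') (ι p) (ι q) (push ι q (extend E v q))
  have hw : ContMDiffAt 𝓘(ℝ, E) 𝓘(ℝ, E') ∞ w p := by
    have h1 : ContDiffAt ℝ ∞ (fun y => fderiv ℝ
        (mapComponents (E := E) (E' := E') p (ι p) ι) y (coframe p p v))
        (extChartAt 𝓘(ℝ, E) p p) :=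
      ((contDiffAt_mapComponents hp hx (hι.contMDiff p)).fderiv_right
        (m := ∞) (by simp)).clm_apply contDiffAt_const
    refine (h1.contMDiffAt.comp p (contMDiffAt_chart hp)).congr_of_eventuallyEq ?_
    filter_upwards [push_extend_eventuallyEq hι.contMDiff v] with q hq using hq.2.2
  refine ⟨fun z => frame (E := E') (ι p) z (w (r z)), ?_, ?_⟩
  · rw [smoothFieldAt_iff hx]
    refine (hw.comp_of_eq hr hrι.self_of_nhds).congr_of_eventuallyEq ?_
    filter_upwards [source_mem_nhds hx] with z hz using coframe_frame hz _
  · filter_upwards [hrι, push_extend_eventuallyEq hι.contMDiff v] with q hq hq'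
    rw [hq]
    exact frame_coframe hq'.2.1 _

variable [FiniteDimensional ℝ E] [FiniteDimensional ℂ E']

/-- The second fundamental form in the preferred charts at `p` and `ι p`. -/
lemma coframe_secondFundamentalForm (hι : Manifold.IsImmersion 𝓘(ℝ, E) 𝓘(ℝ, E') ∞ ι)
    (cov' : AffineConnection E' X) (cov : AffineConnection E M) (u v : TangentSpace 𝓘(ℝ, E) p) :
    coframe (E := E') (ι p) (ι p) (secondFundamentalForm ι cov' cov p u v)
      = hessianAlong (mapComponents (E := E) (E' := E') p (ι p) ι) (christoffel cov' (ι p))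
        (christoffel cov p) (extChartAt 𝓘(ℝ, E) p p) (coframe p p u) (coframe p p v) := by
  have hp := mem_extChartAt_source (I := 𝓘(ℝ, E)) p
  have hx := mem_extChartAt_source (I := 𝓘(ℝ, E')) (ι p)
  obtain ⟨hV, hVι⟩ := Classical.epsilon_spec (exists_isAmbientExtension hι v)
  set V' : ∀ x : X, TangentSpace 𝓘(ℝ, E') x :=
    Classical.epsilon (IsAmbientExtension ι p (extend E v))
  set F := mapComponents (E := E) (E' := E') p (ι p) ι with hF
  have hFp : F (extChartAt 𝓘(ℝ, E) p p) = extChartAt 𝓘(ℝ, E') (ι p) (ι p) :=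
    mapComponents_chart hp
  have hsF : ContDiffAt ℝ ∞ F (extChartAt 𝓘(ℝ, E) p p) :=
    contDiffAt_mapComponents hp hx (hι.contMDiff p)
  have hpush : ∀ a : TangentSpace 𝓘(ℝ, E) p, push ι p a
      = frame (E := E') (ι p) (ι p) (fderiv ℝ F (extChartAt 𝓘(ℝ, E) p p) (coframe p p a)) := by
    intro a
    rw [← mfderiv_frame hp hx (hι.contMDiff p), frame_coframe hp]
  have hW : DifferentiableAt ℝ (components (ι p) V') (F (extChartAt 𝓘(ℝ, E) p p)) := by
    rw [hFp]
    exact (SmoothFieldAt.components hV hx).differentiableAt (by simp)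
  have hev : components (ι p) V' ∘ F =ᶠ[𝓝 (extChartAt 𝓘(ℝ, E) p p)]
      fun y => fderiv ℝ F y (coframe p p v) := by
    filter_upwards [(tendsto_symm hp).eventually
        (hVι.and (push_extend_eventuallyEq hι.contMDiff v)),
      (isOpen_extChartAt_target p).mem_nhds ((extChartAt 𝓘(ℝ, E) p).map_source hp)] with y h1 h2
    obtain ⟨h3, h4, h5, h6⟩ := h1
    rw [(extChartAt 𝓘(ℝ, E) p).right_inv h2, ← h3, ← components_chart V' h5] at h6
    exact h6
  rw [secondFundamentalForm, map_sub, hpush u, coframe_cov cov' hx (hV.mdifferentiableAt (by simp)),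
    ← hFp, ← covAlong_comp hW (hsF.differentiableAt (by simp)), covAlong_congr hev,
    covAlong_fderiv_apply (Γ := christoffel cov p) (v := fun _ => coframe p p v) hsF
      (differentiableAt_const _), hpush, coframe_frame hx]
  have h := coframe_cov_extend cov hp v (coframe p p u)
  rw [frame_coframe hp] at h
  rw [h, covAlong_id]
  simp

end SecondFundamentalForm

/-! ### The algebra at one point -/

section Algebra

/-- Multiplication of a complexified vector by a complex number. -/
def Cx.cmul {V : Type*} [AddCommGroup V] [Module ℝ V] (c : ℂ) (v : Cx V) : Cx V :=
  (c.re • v.1 - c.im • v.2, c.re • v.2 + c.im • v.1)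

lemma Cx.one_cmul {V : Type*} [AddCommGroup V] [Module ℝ V] (v : Cx V) : Cx.cmul 1 v = v := by
  simp [Cx.cmul]

lemma I_smul_I_smul {E : Type*} [AddCommGroup E] [Module ℂ E] (v : E) :
    Complex.I • Complex.I • v = -v := by
  rw [smul_smul, Complex.I_mul_I, neg_one_smul]

variable {E : Type*} [NormedAddCommGroup E] [NormedSpace ℝ E]
  {E' : Type*} [NormedAddCommGroup E'] [NormedSpace ℂ E']

lemma Cx.form_cmul_cmul (g : E' →L[ℝ] E' →L[ℝ] ℝ) (c d : ℂ) (v w : Cx E') :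
    Cx.form (fun u v => g u v) (Cx.cmul c v) (Cx.cmul d w)
      = c * d * Cx.form (fun u v => g u v) v w := by
  apply Complex.ext <;> simp [Cx.form, Cx.cmul] <;> ring

/-- The data of a pseudohermitian submanifold of a Kähler manifold at one point: `D` is the
differential of the immersion, `ℓ` the Levi metric, `B` the second fundamental form, `τ` the
pseudohermitian torsion, and `R`, `R'` are the curvatures. -/
structure IsPseudohermitianPoint (θ : E →L[ℝ] ℝ) (J : E →L[ℝ] E) (T : E) (D : E →L[ℝ] E')
    (g : E' →L[ℝ] E' →L[ℝ] ℝ) (ℓ : E → E → ℝ) (B : E → E → E') (τ : E → E)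
    (R : E → E → E → E) (R' : E' → E' → E' → E') : Prop where
  g_symm : ∀ u v, g u v = g v u
  g_I : ∀ u v, g (Complex.I • u) (Complex.I • v) = g u v
  θ_J : ∀ v, θ v = 0 → θ (J v) = 0
  cr : ∀ v, θ v = 0 → D (J v) = Complex.I • D v
  levi : ∀ u v, θ v = 0 → ℓ u v = g (D u) (D v)
  B_neg_left : ∀ u v, B (-u) v = -B u v
  B_neg_right : ∀ u v, B u (-v) = -B u v
  B_J : ∀ u v, θ v = 0 → B u (J v) = Complex.I • B u v
  B_flip : ∀ u v, θ u = 0 → θ v = 0 → B u v - B v u = -(g (Complex.I • D u) (D v) • D T)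
  gauss : ∀ a b c d, θ a = 0 → θ b = 0 → θ c = 0 → θ d = 0 →
    g (R' (D a) (D b) (D c)) (D d) = g (D (R a b c)) (D d) - g (B b c) (B a d) + g (B a c) (B b d)
      + g (Complex.I • D a) (D b) * g (B T c) (D d)
  torsion : ∀ z w, θ w = 0 → g (B T z) (D w) = -g (D T) (B z w) - g (D (τ z)) (D w)
  θ_τ : ∀ v, θ v = 0 → θ (τ v) = 0
  τ_neg : ∀ v, τ (-v) = -τ v
  τ_J : ∀ v, θ v = 0 → τ (J v) = -J (τ v)

namespace IsPseudohermitianPoint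

variable {θ : E →L[ℝ] ℝ} {J : E →L[ℝ] E} {T : E} {D : E →L[ℝ] E'}
    {g : E' →L[ℝ] E' →L[ℝ] ℝ} {ℓ : E → E → ℝ} {B : E → E → E'} {τ : E → E}
    {R : E → E → E → E} {R' : E' → E' → E' → E'}
    (H : IsPseudohermitianPoint θ J T D g ℓ B τ R R')

include H

lemma g_I_left (u v : E') : g (Complex.I • u) v = -g u (Complex.I • v) := by
  rw [← H.g_I u, smul_smul, Complex.I_mul_I]
  simp

lemma B_J_left {u v : E} (hu : θ u = 0) (hv : θ v = 0) :
    B (J u) v = Complex.I • B u v + (g (Complex.I • D u) (D v)) • (Complex.I • D T)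
      + g (D u) (D v) • D T := by
  have h1 := H.B_flip (J u) v (H.θ_J u hu) hv
  have h2 := H.B_flip u v hu hv
  rw [H.B_J v u hu, H.cr u hu, smul_smul, Complex.I_mul_I, neg_one_smul, map_neg, neg_apply] at h1
  rw [eq_add_of_sub_eq h1, ← sub_eq_of_eq_add' (eq_add_of_sub_eq h2), smul_sub, smul_neg,
    smul_comm Complex.I]
  module

/-- `II(conj y, z) = ⟨conj y, z⟩ H` for `y`, `z` of type `(1, 0)`. Here `H = (𝒥 t + i t) / 2` for
the image `t` of the Reeb field, where `𝒥` is the complex structure of the ambient manifold. -/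
lemma map₂_conj_left {y z : Cx E} (hy : θ y.1 = 0 ∧ y.2 = -J y.1) (hz : θ z.1 = 0 ∧ z.2 = -J z.1) :
    Cx.map₂ B (Cx.conj y) z = Cx.cmul (Cx.form ℓ (Cx.conj y) z)
      ((1 / 2 : ℝ) • Complex.I • D T, (1 / 2 : ℝ) • D T) := by
  obtain ⟨b, b'⟩ := y
  obtain ⟨c, c'⟩ := z
  obtain ⟨hb, rfl : b' = -J b⟩ := hy
  obtain ⟨hc, rfl : c' = -J c⟩ := hz
  simp only at hb hc
  have hJb := H.θ_J b hb
  have hJc := H.θ_J c hc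
  have hs : g (D b) (Complex.I • D c) = -g (Complex.I • D b) (D c) := by rw [H.g_I_left, neg_neg]
  ext
  · simp only [Cx.map₂, Cx.cmul, Cx.form, Cx.conj, neg_neg, H.B_neg_right, H.B_J _ _ hc,
      H.B_J_left hb hc, H.levi _ _ hc, H.levi _ (-J c) (by simp [hJc]), map_neg,
      H.cr b hb, H.cr c hc, H.g_I, hs]
    match_scalars <;> apply Complex.ext <;> simp <;> ring
  · simp only [Cx.map₂, Cx.cmul, Cx.form, Cx.conj, neg_neg, H.B_neg_right, H.B_J _ _ hc,
      H.B_J_left hb hc, H.levi _ _ hc, H.levi _ (-J c) (by simp [hJc]), map_neg,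
      H.cr b hb, H.cr c hc, H.g_I, hs]
    match_scalars <;> apply Complex.ext <;> simp <;> ring

/-- The conjugate statement, `II(z, conj w) = ⟨z, conj w⟩ conj H`. -/
lemma map₂_conj_right {z w : Cx E} (hz : θ z.1 = 0 ∧ z.2 = -J z.1) (hw : θ w.1 = 0 ∧ w.2 = -J w.1) :
    Cx.map₂ B z (Cx.conj w) = Cx.cmul (Cx.form ℓ z (Cx.conj w))
      ((1 / 2 : ℝ) • Complex.I • D T, -((1 / 2 : ℝ) • D T)) := by
  obtain ⟨b, b'⟩ := z
  obtain ⟨c, c'⟩ := w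
  obtain ⟨hb, rfl : b' = -J b⟩ := hz
  obtain ⟨hc, rfl : c' = -J c⟩ := hw
  simp only at hb hc
  have hJb := H.θ_J b hb
  have hJc := H.θ_J c hc
  have hs : g (D b) (Complex.I • D c) = -g (Complex.I • D b) (D c) := by rw [H.g_I_left, neg_neg]
  ext
  · simp only [Cx.map₂, Cx.cmul, Cx.form, Cx.conj, neg_neg, H.B_neg_left, H.B_J _ _ hc,
      H.B_J_left hb hc, H.levi _ _ hc, H.levi _ (J c) (by simp [hJc]), map_neg, neg_apply,
      H.cr b hb, H.cr c hc, H.g_I, hs]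
    match_scalars <;> apply Complex.ext <;> simp <;> ring
  · simp only [Cx.map₂, Cx.cmul, Cx.form, Cx.conj, neg_neg, H.B_neg_left, H.B_J _ _ hc,
      H.B_J_left hb hc, H.levi _ _ hc, H.levi _ (J c) (by simp [hJc]), map_neg, neg_apply,
      H.cr b hb, H.cr c hc, H.g_I, hs]
    match_scalars <;> apply Complex.ext <;> simp <;> ring

/-- The complex multilinear extension of the equation of Gauß. -/
lemma gauss_complex {x y z w : Cx E} (hx : θ x.1 = 0 ∧ θ x.2 = 0) (hy : θ y.1 = 0 ∧ θ y.2 = 0)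
    (hz : θ z.1 = 0 ∧ θ z.2 = 0) (hw : θ w.1 = 0 ∧ θ w.2 = 0) :
    Cx.form (fun u v => g u v) (Cx.map₃ R' (Cx.map D x) (Cx.map D y) (Cx.map D z)) (Cx.map D w)
      = Cx.form ℓ (Cx.map₃ R x y z) w
        - Cx.form (fun u v => g u v) (Cx.map₂ B y z) (Cx.map₂ B x w)
        + Cx.form (fun u v => g u v) (Cx.map₂ B x z) (Cx.map₂ B y w)
        + Cx.form (fun u v => g (Complex.I • D u) (D v)) x y
          * Cx.form (fun u v => g (B T u) (D v)) z w := by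
  have hG := H.gauss
  obtain ⟨hx1, hx2⟩ := hx
  obtain ⟨hy1, hy2⟩ := hy
  obtain ⟨hz1, hz2⟩ := hz
  obtain ⟨hw1, hw2⟩ := hw
  apply Complex.ext <;>
  · simp only [Cx.form, Cx.map₃, Cx.map₂, Cx.map, H.levi _ _ hw1, H.levi _ _ hw2, map_add, map_sub,
      add_apply, sub_apply, Complex.add_re, Complex.sub_re, Complex.mul_re, Complex.add_im,
      Complex.sub_im, Complex.mul_im]
    simp only [hG, hx1, hx2, hy1, hy2, hz1, hz2, hw1, hw2]
    ring

lemma form_conj_symm {y z : Cx E} (hy : θ y.1 = 0 ∧ y.2 = -J y.1)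
    (hz : θ z.1 = 0 ∧ z.2 = -J z.1) : Cx.form ℓ (Cx.conj y) z = Cx.form ℓ z (Cx.conj y) := by
  obtain ⟨b, b'⟩ := y
  obtain ⟨c, c'⟩ := z
  obtain ⟨hb, rfl : b' = -J b⟩ := hy
  obtain ⟨hc, rfl : c' = -J c⟩ := hz
  simp only at hb hc
  have hJb := H.θ_J b hb
  have hJc := H.θ_J c hc
  simp only [Cx.form, Cx.conj, neg_neg, H.levi _ _ hc, H.levi _ _ hb, H.levi _ _ hJb,
    H.levi _ (-J c) (by simp [hJc]), H.g_symm (D b), H.g_symm (D (J b))]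
  rw [add_comm]

/-- The vector `H = (𝒥 t + i t) / 2`, the `(1, 0)`-part of `𝒥 t`, satisfies `|H|² = |t|² / 2`. -/
lemma form_meanCurvature_conj :
    Cx.form (fun u v => g u v) ((1 / 2 : ℝ) • Complex.I • D T, (1 / 2 : ℝ) • D T)
      ((1 / 2 : ℝ) • Complex.I • D T, -((1 / 2 : ℝ) • D T)) = ((g (D T) (D T) / 2 : ℝ) : ℂ) := by
  apply Complex.ext
  · simp [Cx.form, H.g_I]
    ring
  · simp [Cx.form, H.g_symm (D T) (Complex.I • D T)]

/-- `⟨t, c conj H⟩ = -i c |H|²`. -/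
lemma form_reeb_meanCurvature (c : ℂ) :
    Cx.form (fun u v => g u v) (D T, 0) (Cx.cmul c
      ((1 / 2 : ℝ) • Complex.I • D T, -((1 / 2 : ℝ) • D T)))
      = -(Complex.I * c * (g (D T) (D T) / 2 : ℝ)) := by
  have h : g (D T) (Complex.I • D T) = 0 := by
    have := H.g_I_left (D T) (D T)
    rw [H.g_symm] at this
    linarith
  apply Complex.ext
  · simp [Cx.form, Cx.cmul, h]
    left
    ring
  · simp [Cx.form, Cx.cmul, h]
    left
    ring

/-- `⟨II(T, z), w⟩ = -⟨t, II(z, w)⟩ - ⟨τ z, w⟩`, extended complex bilinearly. -/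
lemma torsion_complex (z : Cx E) {w : Cx E} (hw : θ w.1 = 0 ∧ θ w.2 = 0) :
    Cx.form (fun u v => g (B T u) (D v)) z w
      = -Cx.form (fun u v => g u v) (D T, 0) (Cx.map₂ B z w) - Cx.form ℓ (Cx.map τ z) w := by
  obtain ⟨hw1, hw2⟩ := hw
  have hB : ∀ u v, θ v = 0 → g (D T) (B u v) = -g (D (τ u)) (D v) - g (B T u) (D v) :=
    fun u v hv => by rw [H.torsion u v hv]; ring
  apply Complex.ext <;>
  · simp [Cx.form, Cx.map₂, Cx.map, H.levi _ _ hw1, H.levi _ _ hw2, hB, hw1, hw2]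
    try ring

/-- `τ` maps vectors of type `(1, 0)` to vectors of type `(0, 1)`. -/
lemma form_torsion_conj {z w : Cx E} (hz : θ z.1 = 0 ∧ z.2 = -J z.1)
    (hw : θ w.1 = 0 ∧ w.2 = -J w.1) : Cx.form ℓ (Cx.map τ z) (Cx.conj w) = 0 := by
  obtain ⟨b, b'⟩ := z
  obtain ⟨c, c'⟩ := w
  obtain ⟨hb, rfl : b' = -J b⟩ := hz
  obtain ⟨hc, rfl : c' = -J c⟩ := hw
  simp only at hb hc
  have hJc := H.θ_J c hc
  apply Complex.ext <;>
  simp [Cx.form, Cx.map, Cx.conj, H.τ_neg, H.τ_J _ hb, H.levi _ _ hc, H.levi _ _ hJc, H.cr c hc,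
    H.cr _ (H.θ_τ b hb), H.g_I, H.g_I_left]

/-- The equation of Gauß for curvature. -/
lemma gauss_curvature {x y z w : Cx E} (hx : θ x.1 = 0 ∧ x.2 = -J x.1)
    (hy : θ y.1 = 0 ∧ y.2 = -J y.1) (hz : θ z.1 = 0 ∧ z.2 = -J z.1)
    (hw : θ w.1 = 0 ∧ w.2 = -J w.1) :
    Cx.form (fun u v => g u v) (Cx.map₃ R' (Cx.map D x) (Cx.map D (Cx.conj y)) (Cx.map D z))
        (Cx.map D (Cx.conj w))
      = Cx.form ℓ (Cx.map₃ R x (Cx.conj y) z) (Cx.conj w)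
        + Cx.form (fun u v => g u v) (Cx.map₂ B x z) (Cx.map₂ B (Cx.conj y) (Cx.conj w))
        - (g (D T) (D T) / 2 : ℝ) * (Cx.form ℓ (Cx.conj y) z * Cx.form ℓ x (Cx.conj w)
          + Cx.form ℓ x (Cx.conj y) * Cx.form ℓ z (Cx.conj w)) := by
  have hh : ∀ {v : Cx E}, (θ v.1 = 0 ∧ v.2 = -J v.1) → θ v.1 = 0 ∧ θ v.2 = 0 := fun {v} h =>
    ⟨h.1, by rw [h.2, map_neg, H.θ_J _ h.1, neg_zero]⟩
  have hc : ∀ {v : Cx E}, (θ v.1 = 0 ∧ v.2 = -J v.1) →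
      θ (Cx.conj v).1 = 0 ∧ θ (Cx.conj v).2 = 0 := fun {v} h =>
    ⟨h.1, by simpa [Cx.conj] using (hh h).2⟩
  -- `dθ = i ⟨·, ·⟩` on pairs of vectors of types `(1, 0)` and `(0, 1)`.
  have hΩ : Cx.form (fun u v => g (Complex.I • D u) (D v)) x (Cx.conj y)
      = Complex.I * Cx.form ℓ x (Cx.conj y) := by
    obtain ⟨b, b'⟩ := x
    obtain ⟨c, c'⟩ := y
    obtain ⟨hb, rfl : b' = -J b⟩ := hx
    obtain ⟨hc, rfl : c' = -J c⟩ := hy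
    simp only at hb hc
    have hJc := H.θ_J c hc
    apply Complex.ext
    · simp [Cx.form, Cx.conj, H.levi _ _ hc, H.levi _ _ hJc, H.cr _ hc, H.cr _ hb, H.g_I_left,
        I_smul_I_smul]
      ring
    · simp [Cx.form, Cx.conj, H.levi _ _ hc, H.levi _ _ hJc, H.cr _ hc, H.cr _ hb, H.g_I,
        I_smul_I_smul]
  rw [H.gauss_complex (hh hx) (hc hy) (hh hz) (hc hw), H.map₂_conj_left hy hz,
    H.map₂_conj_right hx hw, Cx.form_cmul_cmul, H.form_meanCurvature_conj, hΩ,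
    H.torsion_complex z (hc hw), H.form_torsion_conj hz hw, H.map₂_conj_right hz hw,
    H.form_reeb_meanCurvature]
  linear_combination (Cx.form ℓ x (Cx.conj y) * Cx.form ℓ z (Cx.conj w)
    * (g (D T) (D T) / 2 : ℝ)) * Complex.I_mul_I

/-- The equation of Gauß for the pseudohermitian torsion. -/
lemma gauss_torsion {x z : Cx E} (hx : θ x.1 = 0 ∧ x.2 = -J x.1)
    (hz : θ z.1 = 0 ∧ z.2 = -J z.1) :
    Cx.form ℓ (Cx.map τ x) z = -Complex.I * Cx.form (fun u v => g u v) (Cx.map₂ B x z)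
      ((1 / 2 : ℝ) • Complex.I • D T, -((1 / 2 : ℝ) • D T)) := by
  have hh : ∀ {v : Cx E}, (θ v.1 = 0 ∧ v.2 = -J v.1) → θ v.1 = 0 ∧ θ v.2 = 0 := fun {v} h =>
    ⟨h.1, by rw [h.2, map_neg, H.θ_J _ h.1, neg_zero]⟩
  have h := H.torsion_complex x (hh hz)
  obtain ⟨b, b'⟩ := x
  obtain ⟨c, c'⟩ := z
  obtain ⟨hb, rfl : b' = -J b⟩ := hx
  obtain ⟨hc, rfl : c' = -J c⟩ := hz
  simp only at hb hc
  have hJb := H.θ_J b hb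
  have hJc := H.θ_J c hc
  have hI : ∀ (r : ℝ) (v : E'), Complex.I • r • v = r • Complex.I • v := fun r v =>
    smul_comm _ _ _
  -- `II(T, x)` and `z` are both of type `(1, 0)`.
  have h0 : Cx.form (fun u v => g (B T u) (D v)) (b, -J b) (c, -J c) = 0 := by
    apply Complex.ext <;>
    simp [Cx.form, H.cr _ hc, H.B_neg_right, H.B_J _ _ hb, H.g_I_left, I_smul_I_smul]
  have hB : Cx.map₂ B (b, -J b) (c, -J c)
      = (B b c - B (J b) (J c), -(Complex.I • (B b c - B (J b) (J c)))) := by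
    ext
    · simp [Cx.map₂, H.B_neg_left, H.B_neg_right]
    · simp [Cx.map₂, H.B_neg_left, H.B_neg_right, H.B_J _ _ hc, smul_sub, smul_smul]
      module
  rw [h0, hB] at h
  rw [← sub_eq_zero.1 h.symm, hB]
  generalize B b c - B (J b) (J c) = P
  apply Complex.ext <;>
  · simp [Cx.form, H.g_I, H.g_I_left, H.g_symm (D T), hI]
    try ring

end IsPseudohermitianPoint
end Algebra

/-! ### The tangent spaces at a point of a pseudohermitian submanifold -/

section Point

variable {E : Type*} [NormedAddCommGroup E] [NormedSpace ℝ E] [FiniteDimensional ℝ E]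
  {M : Type*} [TopologicalSpace M] [ChartedSpace E M] [IsManifold 𝓘(ℝ, E) ∞ M]
  {E' : Type*} [NormedAddCommGroup E'] [NormedSpace ℂ E'] [FiniteDimensional ℂ E']
  {X : Type*} [TopologicalSpace X] [ChartedSpace E' X] [IsManifold 𝓘(ℂ, E') ω X]
  {S : PseudohermitianStructure E M} {g : RealMetric E' X} {ι : M → X}

omit [FiniteDimensional ℝ E] in
/-- As `J T = 0`, the whole image of `J` is horizontal. -/
lemma PseudohermitianStructure.θ_J_apply (S : PseudohermitianStructure E M) (p : M)
    (v : TangentSpace 𝓘(ℝ, E) p) : S.θ p (S.J p v) = 0 := by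
  have h := S.θ_J p (v - S.θ p v • S.T p) (by simp [S.θ_T])
  rwa [map_sub, map_smul, S.J_T, smul_zero, sub_zero] at h

/-- The equations in the charts at `p` and `ι p`, carried over to the tangent spaces at `p` and
`ι p`. -/
lemma isPseudohermitianPoint (hg : IsKahler g)
    (hι : IsPseudohermitianSubmanifold S g ι) {cov' : AffineConnection E' X}
    (hcov' : IsChernConnection g cov') {cov : AffineConnection E M} (hcov : S.IsTanakaWebster cov)
    (p : M) :
    IsPseudohermitianPoint (E := E) (E' := E') (S.θ p) (S.J p) (S.T p) (push ι p) (g.inner (ι p))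
      (S.leviMetric p) (secondFundamentalForm ι cov' cov p) (torsionTensor cov p (S.T p))
      (curvatureTensor cov p) (curvatureTensor cov' (ι p)) := by
  have H := isLocalPseudohermitianSubmanifold hg hι hcov' hcov p
  have hp := mem_extChartAt_source (I := 𝓘(ℝ, E)) p
  have hx := mem_extChartAt_source (I := 𝓘(ℝ, E')) (ι p)
  set U := (extChartAt 𝓘(ℝ, E) p).target ∩
        (ι ∘ (extChartAt 𝓘(ℝ, E) p).symm) ⁻¹' (extChartAt 𝓘(ℝ, E') (ι p)).source
  set F := mapComponents (E := E) (E' := E') p (ι p) ι with hF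
  set y := extChartAt 𝓘(ℝ, E) p p with hy
  have hyU : y ∈ U := by
    refine ⟨(extChartAt 𝓘(ℝ, E) p).map_source hp, ?_⟩
    rw [Set.mem_preimage, Function.comp_apply, (extChartAt 𝓘(ℝ, E) p).left_inv hp]
    exact hx
  have hFy : F y = extChartAt 𝓘(ℝ, E') (ι p) (ι p) := mapComponents_chart hp
  have hθ : ∀ u : TangentSpace 𝓘(ℝ, E) p, formComponents p S.θ y (coframe p p u) = S.θ p u := by
    intro u
    rw [formComponents_apply _ hp, frame_coframe hp]
  have hT : components p S.T y = coframe p p (S.T p) := components_chart _ hp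
  have hJ : ∀ u : TangentSpace 𝓘(ℝ, E) p,
      endComponents p S.J y (coframe p p u) = coframe p p (S.J p u) := by
    intro u
    rw [endComponents_apply _ hp, frame_coframe hp]
  have hD : ∀ u : TangentSpace 𝓘(ℝ, E) p,
      fderiv ℝ F y (coframe p p u) = coframe (E := E') (ι p) (ι p) (push ι p u) := by
    intro u
    rw [← coframe_mfderiv hp hx (hι.contMDiffAt p), frame_coframe hp]
  have hgv : ∀ a b : TangentSpace 𝓘(ℝ, E') (ι p),
      bilinComponents (ι p) g.inner (F y) (coframe (E := E') (ι p) (ι p) a)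
        (coframe (E := E') (ι p) (ι p) b) = g.inner (ι p) a b := by
    intro a b
    rw [hFy, bilinComponents_inner hx, frame_coframe hx, frame_coframe hx]
    rfl
  have hI : ∀ a : TangentSpace 𝓘(ℝ, E') (ι p), Complex.I • coframe (E := E') (ι p) (ι p) a
      = coframe (E := E') (ι p) (ι p) (complexStructure (ι p) a) := fun a =>
    (coframe_complexStructure hx a).symm
  have hB : ∀ u v : TangentSpace 𝓘(ℝ, E) p,
      hessianAlong F (christoffel cov' (ι p)) (christoffel cov p) y (coframe p p u) (coframe p p v)
      = coframe (E := E') (ι p) (ι p) (secondFundamentalForm ι cov' cov p u v) := fun u v =>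
    (coframe_secondFundamentalForm hι.immersion cov' cov u v).symm
  have hR : ∀ a b c : TangentSpace 𝓘(ℝ, E) p,
      christoffelCurvature (christoffel cov p) y (coframe p p a) (coframe p p b) (coframe p p c)
      = coframe p p (curvatureTensor cov p a b c) := fun a b c =>
    (coframe_curvatureTensor hcov.smooth p a b c).symm
  have hR' : ∀ a b c : TangentSpace 𝓘(ℝ, E') (ι p),
      christoffelCurvature (christoffel cov' (ι p)) (F y) (coframe (E := E') (ι p) (ι p) a)
        (coframe (E := E') (ι p) (ι p) b) (coframe (E := E') (ι p) (ι p) c)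
      = coframe (E := E') (ι p) (ι p) (curvatureTensor cov' (ι p) a b c) := fun a b c => by
    rw [hFy]
    exact (coframe_curvatureTensor hcov'.smooth (ι p) a b c).symm
  have hτ : ∀ u v : TangentSpace 𝓘(ℝ, E) p,
      christoffel cov p y (coframe p p v) (coframe p p u)
        - christoffel cov p y (coframe p p u) (coframe p p v)
      = coframe p p (torsionTensor cov p u v) := fun u v => by
    rw [← coframe_torsionTensor cov hp, frame_coframe hp, frame_coframe hp]
  have hinj : ∀ {a b : TangentSpace 𝓘(ℝ, E') (ι p)}, coframe (E := E') (ι p) (ι p) a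
      = coframe (E := E') (ι p) (ι p) b → a = b := fun {a b} h => by
    rw [← frame_coframe hx a, h, frame_coframe hx]
  have hinj' : ∀ {a b : TangentSpace 𝓘(ℝ, E) p}, coframe p p a = coframe p p b → a = b :=
    fun {a b} h => by rw [← frame_coframe hp a, h, frame_coframe hp]
  have levi : ∀ u v : TangentSpace 𝓘(ℝ, E) p, S.θ p v = 0 →
      S.leviMetric p u v = g.inner (ι p) (push ι p u) (push ι p v) := by
    intro u v hv
    refine (hι.semiIsometric p u (S.J p v)).trans ?_
    rw [hι.cr p v hv]
    exact hg.hermitian _ _ _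
  have B_neg_left : ∀ u v : TangentSpace 𝓘(ℝ, E) p, secondFundamentalForm ι cov' cov p (-u) v
      = -secondFundamentalForm ι cov' cov p u v := by
    intro u v
    refine hinj ?_
    rw [map_neg, ← hB, ← hB, map_neg]
    simp only [hessianAlong, map_neg, neg_apply]
    abel
  have B_neg_right : ∀ u v : TangentSpace 𝓘(ℝ, E) p, secondFundamentalForm ι cov' cov p u (-v)
      = -secondFundamentalForm ι cov' cov p u v := by
    intro u v
    refine hinj ?_
    rw [map_neg, ← hB, ← hB, map_neg]
    simp only [hessianAlong, map_neg, neg_apply]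
    abel
  have B_J : ∀ u v : TangentSpace 𝓘(ℝ, E) p, S.θ p v = 0 →
      secondFundamentalForm ι cov' cov p u (S.J p v)
        = complexStructure (ι p) (secondFundamentalForm ι cov' cov p u v) := by
    intro u v hv
    refine hinj ?_
    rw [← hθ] at hv
    rw [← hB, ← hJ, H.hessian_J hyU _ hv, hB, hI]
  have B_flip : ∀ u v : TangentSpace 𝓘(ℝ, E) p, S.θ p u = 0 → S.θ p v = 0 →
      secondFundamentalForm ι cov' cov p u v - secondFundamentalForm ι cov' cov p v u
        = -(g.inner (ι p) (complexStructure (ι p) (push ι p u)) (push ι p v)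
          • push ι p (S.T p)) := by
    intro u v hu hv
    refine hinj ?_
    rw [← hθ] at hu hv
    have h := H.hessian_sub_flip_horizontal hyU hu hv
    rw [hB, hB, hD, hD, hT, hD, hI, hgv] at h
    rw [map_sub, h, map_neg, map_smul]
  have gauss : ∀ a b c d : TangentSpace 𝓘(ℝ, E) p, S.θ p a = 0 → S.θ p b = 0 → S.θ p c = 0 →
      S.θ p d = 0 →
      g.inner (ι p) (curvatureTensor cov' (ι p) (push ι p a) (push ι p b) (push ι p c))
          (push ι p d)
        = g.inner (ι p) (push ι p (curvatureTensor cov p a b c)) (push ι p d)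
          - g.inner (ι p) (secondFundamentalForm ι cov' cov p b c)
            (secondFundamentalForm ι cov' cov p a d)
          + g.inner (ι p) (secondFundamentalForm ι cov' cov p a c)
            (secondFundamentalForm ι cov' cov p b d)
          + g.inner (ι p) (complexStructure (ι p) (push ι p a)) (push ι p b)
            * g.inner (ι p) (secondFundamentalForm ι cov' cov p (S.T p) c) (push ι p d) := by
    intro a b c d ha hb hc hd
    rw [← hθ] at ha hb hc hd
    have h := H.gauss hyU ha hb hc hd
    simp only [hB, hD, hT, hI, hgv, hR, hR'] at h
    exact h
  have torsion : ∀ z w : TangentSpace 𝓘(ℝ, E) p, S.θ p w = 0 →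
      g.inner (ι p) (secondFundamentalForm ι cov' cov p (S.T p) z) (push ι p w)
        = -g.inner (ι p) (push ι p (S.T p)) (secondFundamentalForm ι cov' cov p z w)
          - g.inner (ι p) (push ι p (torsionTensor cov p (S.T p) z)) (push ι p w) := by
    intro z w hw
    rw [← hθ] at hw
    have h := H.torsion_T hyU (coframe p p z) hw
    simp only [hB, hD, hT, hτ, hgv] at h
    exact h
  have θ_τ : ∀ v : TangentSpace 𝓘(ℝ, E) p, S.θ p v = 0 →
      S.θ p (torsionTensor cov p (S.T p) v) = 0 := by
    intro v hv
    have h := hcov.torsion_T p (-S.J p v) (by rw [map_neg, S.θ_J p v hv, neg_zero])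
    rw [map_neg, S.J_J p v hv, neg_neg] at h
    rw [h, map_neg, S.θ_J_apply, neg_zero]
  have τ_neg : ∀ v : TangentSpace 𝓘(ℝ, E) p,
      torsionTensor cov p (S.T p) (-v) = -torsionTensor cov p (S.T p) v := by
    intro v
    refine hinj' ?_
    rw [map_neg, ← hτ, ← hτ, map_neg]
    simp only [map_neg, neg_apply]
    abel
  exact
    { g_symm := fun u v => g.symm _ _ _
      g_I := hg.hermitian (ι p)
      θ_J := S.θ_J p
      cr := hι.cr p
      levi := levi
      B_neg_left := B_neg_left
      B_neg_right := B_neg_right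
      B_J := B_J
      B_flip := B_flip
      gauss := gauss
      torsion := torsion
      θ_τ := θ_τ
      τ_neg := τ_neg
      τ_J := hcov.torsion_T p }

/-- The `(1, 0)`-mean curvature vector is the `(1, 0)`-part of `𝒥 t`, for the image `t` of the Reeb
field. -/
lemma meanCurvature_eq (hg : IsKahler g)
    (hι : IsPseudohermitianSubmanifold S g ι) {cov' : AffineConnection E' X}
    (hcov' : IsChernConnection g cov') {cov : AffineConnection E M} (hcov : S.IsTanakaWebster cov)
    {p : M} {n : ℕ} (hn : n ≠ 0) {e : Fin n → Cx (TangentSpace 𝓘(ℝ, E) p)}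
    (he : S.IsOrthonormalBasis p e) :
    meanCurvature ι cov' cov p e
      = ((1 / 2 : ℝ) • complexStructure (ι p) (push ι p (S.T p)),
        (1 / 2 : ℝ) • push ι p (S.T p)) := by
  have H := isPseudohermitianPoint hg hι hcov' hcov p
  have hα : ∀ α, II ι cov' cov p (Cx.conj (e α)) (e α)
      = ((1 / 2 : ℝ) • complexStructure (ι p) (push ι p (S.T p)),
        (1 / 2 : ℝ) • push ι p (S.T p)) := by
    intro α
    have h1 : Cx.form (S.leviMetric p) (Cx.conj (e α)) (e α) = 1 :=
      (H.form_conj_symm (he.1 α) (he.1 α)).trans ((he.2 α α).trans (if_pos rfl))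
    exact (H.map₂_conj_left (he.1 α) (he.1 α)).trans
      ((congrArg (fun c => Cx.cmul c _) h1).trans (Cx.one_cmul _))
  have hn' : (n : ℝ) ≠ 0 := Nat.cast_ne_zero.2 hn
  rw [meanCurvature, Finset.sum_congr rfl fun α _ => hα α, Finset.sum_const, Finset.card_univ,
    Fintype.card_fin, ← Nat.cast_smul_eq_nsmul ℝ, inv_smul_smul₀ hn']

omit [FiniteDimensional ℝ E] in
/-- If `dim M = 1`, then `ker θ = 0`. -/
lemma PseudohermitianStructure.eq_zero_of_finrank_eq_one (S : PseudohermitianStructure E M)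
    (h1 : Module.finrank ℝ E = 1) {p : M} {v : TangentSpace 𝓘(ℝ, E) p} (hv : S.θ p v = 0) :
    v = 0 := by
  have hT : S.T p ≠ 0 := fun h => by simpa [h] using S.θ_T p
  obtain ⟨c, rfl⟩ := exists_smul_eq_of_finrank_eq_one (V := TangentSpace 𝓘(ℝ, E) p) h1 hT v
  rw [map_smul, S.θ_T, smul_eq_mul, mul_one] at hv
  rw [hv]
  exact zero_smul ℝ (S.T p)

end Point

end CRGeom

end

open CRGeom
theorem proposition2p9
    {E : Type*} [NormedAddCommGroup E] [NormedSpace ℝ E] [FiniteDimensional ℝ E]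
    {M : Type*} [TopologicalSpace M] [T2Space M] [ChartedSpace E M] [IsManifold 𝓘(ℝ, E) ∞ M]
    {E' : Type*} [NormedAddCommGroup E'] [NormedSpace ℂ E'] [FiniteDimensional ℂ E']
    {X : Type*} [TopologicalSpace X] [T2Space X] [ChartedSpace E' X] [IsManifold 𝓘(ℂ, E') ω X]
    (n : ℕ) (hn : Module.finrank ℝ E = 2 * n + 1)
    (S : PseudohermitianStructure E M)
    (g : RealMetric E' X) (hg : IsKahler g)
    (ι : M → X) (hι : IsPseudohermitianSubmanifold S g ι)
    (cov' : AffineConnection E' X) (hcov' : IsChernConnection g cov')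
    (cov : AffineConnection E M) (hcov : S.IsTanakaWebster cov)
    (p : M) (e : Fin n → Cx (TangentSpace 𝓘(ℝ, E) p)) (he : S.IsOrthonormalBasis p e) :
    (∀ x y z w : Cx (TangentSpace 𝓘(ℝ, E) p),
      x ∈ S.T10 p → y ∈ S.T10 p → z ∈ S.T10 p → w ∈ S.T10 p →
      Cx.form (g.val (ι p))
          (Cx.map₃ (curvatureTensor cov' (ι p)) (Cx.map (push ι p) x)
            (Cx.map (push ι p) (Cx.conj y)) (Cx.map (push ι p) z))
          (Cx.map (push ι p) (Cx.conj w)) =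
        Cx.form (S.leviMetric p) (Cx.map₃ (curvatureTensor cov p) x (Cx.conj y) z) (Cx.conj w)
        + Cx.form (g.val (ι p)) (II ι cov' cov p x z) (II ι cov' cov p (Cx.conj y) (Cx.conj w))
        - Cx.form (g.val (ι p)) (meanCurvature ι cov' cov p e)
            (Cx.conj (meanCurvature ι cov' cov p e))
          * (Cx.form (S.leviMetric p) (Cx.conj y) z * Cx.form (S.leviMetric p) x (Cx.conj w)
            + Cx.form (S.leviMetric p) x (Cx.conj y) * Cx.form (S.leviMetric p) z (Cx.conj w))) ∧
    (∀ x z : Cx (TangentSpace 𝓘(ℝ, E) p), x ∈ S.T10 p → z ∈ S.T10 p →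
      Cx.form (S.leviMetric p) (Cx.map (torsionTensor cov p (S.T p)) x) z =
        -Complex.I * Cx.form (g.val (ι p)) (II ι cov' cov p x z)
          (Cx.conj (meanCurvature ι cov' cov p e))) := by
  have H := isPseudohermitianPoint hg hι hcov' hcov p
  rcases Nat.eq_zero_or_pos n with rfl | hn0
  · -- For `n = 0` all vectors of type `(1, 0)` vanish.
    have h0 : ∀ x ∈ S.T10 p, x = 0 := by
      intro x hx
      have h1 := S.eq_zero_of_finrank_eq_one hn hx.1
      refine Prod.ext h1 ?_
      rw [hx.2, h1, map_zero]
      exact neg_zero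
    have hl : ∀ u : TangentSpace 𝓘(ℝ, E) p, S.leviMetric p u 0 = 0 := by
      intro u
      exact (H.levi u 0 (map_zero _)).trans
        ((congrArg (g.inner (ι p) (push ι p u)) (map_zero (push ι p))).trans (map_zero _))
    have hform : ∀ x : Cx (TangentSpace 𝓘(ℝ, E) p), Cx.form (S.leviMetric p) x 0 = 0 := by
      intro x
      apply Complex.ext <;> simp [Cx.form, hl]
    have hconj : Cx.conj (0 : Cx (TangentSpace 𝓘(ℝ, E) p)) = 0 := by simp [Cx.conj]
    refine ⟨fun x y z w hx hy hz hw => ?_, fun x z hx hz => ?_⟩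
    · have hK : ∀ r s : ℂ, r * (Cx.form (S.leviMetric p) (Cx.conj y) z
            * Cx.form (S.leviMetric p) x (Cx.conj w)
          + Cx.form (S.leviMetric p) x (Cx.conj y) * Cx.form (S.leviMetric p) z (Cx.conj w))
          = s * (Cx.form (S.leviMetric p) (Cx.conj y) z * Cx.form (S.leviMetric p) x (Cx.conj w)
          + Cx.form (S.leviMetric p) x (Cx.conj y) * Cx.form (S.leviMetric p) z (Cx.conj w)) := by
        intro r s
        rw [h0 w hw, hconj, hform, hform, mul_zero, mul_zero, add_zero, mul_zero, mul_zero]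
      exact (H.gauss_curvature hx hy hz hw).trans (congrArg₂ (· - ·) rfl (hK _ _))
    · rw [h0 z hz, hform, meanCurvature]
      simp [Cx.form, Cx.conj, RealMetric.val]
      rfl
  · have hm := meanCurvature_eq hg hι hcov' hcov hn0.ne' he
    refine ⟨fun x y z w hx hy hz hw => ?_, fun x z hx hz => ?_⟩
    · rw [hm]
      refine (H.gauss_curvature hx hy hz hw).trans (congrArg₂ (· - ·) rfl ?_)
      exact congrArg (· * _) H.form_meanCurvature_conj.symm
    · rw [hm]
      exact H.gauss_torsion hx hz
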